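/- All rings are commutative with $1$, and rings are not assumed Noetherian; a local ring is a ring with a unique maximal ideal. An ideal is regular if it contains a nonzerodivisor. An ideal is stable if it is projective as a module over its ring of endomorphisms, and a ring is stable if each of its regular ideals is stable. A ring is a Dedekind ring if each of its regular ideals is invertible (zerodivisors are allowed). An extension of rings $R\subseteq S$ is quadratic if $xy\in xR+yR+R$ for all $x,y\in S$. Let $Q(R)$ denote the total ring of quotients of $R$ and $\operatorname{Jac} A$ the Jacobson radical of a ring $A$. Put $R_0=R$, $R_{i}=\{q\in Q(R): q\operatorname{Jac}R_{i-1}\subseteq \operatorname{Jac}R_{i-1}\}$ for $i\ge 1$, and $R_\infty=\bigcup_{i\ge 1}R_i$. The ring $R$ is a quadratic ring if $R$ is local, $R\subseteq R_\infty$ is a quadratic extension, and the maximal ideal of $R$ is stable and regular. Corollary 4.4. Let $R$ be a local ring of Krull dimension one whose maximal ideal is regular. Then $R$ is a quadratic ring if and only if either $R$ is a stable ring, or $R=k+\operatorname{Jac}S$, where $k$ is the prime subring of $R$ and $S$ is a Dedekind ring with $R\subseteq S\subseteq Q(R)$ that has exactly three maximal ideals, each with residue field isomorphic to $\mathbb{F}_2$.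 -/

import Mathlib

open scoped Pointwise

namespace OneDimStable

/-- A regular ideal: an ideal containing a nonzerodivisor. -/
def IsRegularIdeal {R : Type*} [CommRing R] (I : Ideal R) : Prop :=
  ∃ x ∈ I, x ∈ nonZeroDivisors R

/-- A stable ideal: an ideal that is projective as a module over its ring of endomorphisms
(the ring `End_R(I)` acting on `I` by evaluation). -/
def IsStableIdeal {R : Type*} [CommRing R] (I : Ideal R) : Prop :=
  Module.Projective (Module.End R I) I

/-- A stable ring: every regular ideal is stable. -/
def IsStableRing (R : Type*) [CommRing R] : Prop :=
  ∀ I : Ideal R, IsRegularIdeal I → IsStableIdeal I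

/-- A Dedekind ring, zerodivisors allowed: every regular ideal is invertible, that is, it is a unit
in the monoid of fractional ideals inside the total ring of quotients. -/
def IsDedekindWithZeroDivisors (A : Type*) [CommRing A] : Prop :=
  ∀ I : Ideal A, IsRegularIdeal I →
    IsUnit (I : FractionalIdeal (nonZeroDivisors A) (FractionRing A))

/-- A quadratic extension `R ⊆ S`: `x y ∈ x R + y R + R` for all `x, y ∈ S`. -/
def IsQuadraticExtension (R S : Type*) [CommRing R] [CommRing S] [Algebra R S] : Prop :=
  ∀ x y : S, x * y ∈ Submodule.span R ({x, y, 1} : Set S)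

section Tower

variable {R Q : Type*} [CommRing R] [CommRing Q] [Algebra R Q]

/-- The Jacobson radical of a ring `A` between `R` and `Q`, as a subset of `Q`. -/
def jac (A : Subalgebra R Q) : Submodule R Q :=
  ((Ideal.jacobson (⊥ : Ideal A)).restrictScalars R).map A.val.toLinearMap

/-- The ring `E(I) = {q ∈ Q : q I ⊆ I}`. -/
def endRing (I : Submodule R Q) : Subalgebra R Q where
  carrier := {q | ∀ x ∈ I, q * x ∈ I}
  mul_mem' := fun {a b} ha hb x hx => by
    rw [mul_assoc]
    exact ha _ (hb x hx)
  add_mem' := fun {a b} ha hb x hx => by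
    rw [add_mul]
    exact I.add_mem (ha x hx) (hb x hx)
  algebraMap_mem' := fun r x hx => by
    rw [← Algebra.smul_def]
    exact I.smul_mem r hx

variable (R Q)

/-- The tower `R_0 = R`, `R_{i+1} = E(Jac R_i)` of rings inside `Q`. -/
def tower : ℕ → Subalgebra R Q
  | 0 => ⊥
  | i + 1 => endRing (jac (tower i))

/-- The ring `R_∞`, the union of the increasing chain `R_0 ⊆ R_1 ⊆ R_2 ⊆ ⋯`. -/
def towerTop : Subalgebra R Q := ⨆ i, tower R Q i

end Tower

/-- A quadratic ring `R` with total ring of quotients `Q`: `R` is local, `R ⊆ R_∞` is a quadratic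
extension, and the maximal ideal of `R` is stable and regular. -/
structure IsQuadraticRing (R Q : Type*) [CommRing R] [CommRing Q] [Algebra R Q]
    [IsFractionRing R Q] : Prop where
  [isLocalRing : IsLocalRing R]
  isQuadraticExtension : IsQuadraticExtension R (towerTop R Q)
  isStableIdeal : IsStableIdeal (IsLocalRing.maximalIdeal R)
  isRegularIdeal : IsRegularIdeal (IsLocalRing.maximalIdeal R)

end OneDimStable

/-
A regular ideal `I` is stable exactly when it is invertible over its ring of multipliers `E(I)`,
and an invertible ideal of a semilocal ring is principal. If `R` is stable and `I` is the `R`-module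
generated by `x`, `y` and `1` in a ring of the tower, then `I` is invertible over `E(I)`, and its
inverse is a finitely generated ideal of `E(I)` all of whose powers contain a common regular
element. In dimension one such an ideal is the whole ring, so `I = E(I)` and `x y ∈ I`.

Conversely, a quadratic extension of a local ring has at most three maximal ideals, and if it has
three, then all its residue fields are `𝔽₂`. For a quadratic ring `R` this applies to `R_∞`, whose
regular ideals are principal because its Jacobson radical is. If `R_∞` has at most two maximal
ideals, then prime avoidance makes every extended ideal `I R_∞` principal on an element `i` of `I`;
since `R ⊆ R_∞` is quadratic, `I² = i I`, so `I` is stable. If it has three, then already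
`R_∞ = R_1`, hence `Jac R_∞ = Jac R`, and `S = R_∞` is the required Dedekind ring. In the other
direction `Jac S = Jac R` gives `R_∞ = S`; as `S` has only three maximal ideals, some pair of
residues `(a, b)` in `𝔽₂ × 𝔽₂` is attained by `(x, y)` at none of them, so that
`(x - a - 1) (y - b - 1) ∈ Jac S ⊆ R`, a quadratic relation.
-/

namespace OneDimStable

open IsLocalRing Module
open scoped nonZeroDivisors

section QuadraticExtension

variable {R C : Type*} [CommRing R] [CommRing C] [Algebra R C]

namespace IsQuadraticExtension

theorem exists_mul_eq (hq : IsQuadraticExtension R C) (x y : C) :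
    ∃ a b c : R, x * y = algebraMap R C a * x + algebraMap R C b * y + algebraMap R C c := by
  obtain ⟨a, b, c, h⟩ := Submodule.mem_span_triple.1 (hq x y)
  exact ⟨a, b, c, by simp [← h, Algebra.smul_def]⟩

theorem exists_sq_eq (hq : IsQuadraticExtension R C) (x : C) :
    ∃ a c : R, x ^ 2 = algebraMap R C a * x + algebraMap R C c := by
  obtain ⟨a, b, c, h⟩ := hq.exists_mul_eq x x
  exact ⟨a + b, c, by rw [sq, h, map_add]; ring⟩

theorem isIntegral (hq : IsQuadraticExtension R C) : Algebra.IsIntegral R C := by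
  refine ⟨fun x => ?_⟩
  obtain ⟨a, c, h⟩ := hq.exists_sq_eq x
  refine ⟨Polynomial.X ^ 2 - (Polynomial.C a * Polynomial.X + Polynomial.C c),
    Polynomial.monic_X_pow_sub (Polynomial.degree_linear_le.trans_lt (by norm_num)), ?_⟩
  simp [h]

theorem of_surjective {k K : Type*} [CommRing k] [CommRing K] [Algebra k K]
    (hq : IsQuadraticExtension R C) (f : R →+* k) (g : C →+* K) (hg : Function.Surjective g)
    (hfg : ∀ r, g (algebraMap R C r) = algebraMap k K (f r)) : IsQuadraticExtension k K := by
  refine hg.forall₂.2 fun x y => ?_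
  obtain ⟨a, b, c, h⟩ := hq.exists_mul_eq x y
  refine Submodule.mem_span_triple.2 ⟨f a, f b, f c, ?_⟩
  simp [Algebra.smul_def, ← hfg, ← map_mul, ← map_add, h]

theorem pi_quotient {ι : Type*} [Finite ι] (hq : IsQuadraticExtension R C) (p : Ideal R)
    (P : ι → Ideal C) [∀ i, (P i).LiesOver p] (hP : Pairwise (Function.onFun IsCoprime P)) :
    IsQuadraticExtension (R ⧸ p) (∀ i, C ⧸ P i) :=
  hq.of_surjective (Ideal.Quotient.mk p) (RingHom.pi fun i => Ideal.Quotient.mk (P i))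
    (fun y => (Ideal.pi_quotient_surjective hP y).imp fun _ => funext) fun _ => rfl

section Pi

variable {k ι : Type*} {K : ι → Type*} [Field k] [∀ i, CommRing (K i)] [∀ i, Algebra k (K i)]

theorem exists_mul_apply_eq (hq : IsQuadraticExtension k (∀ i, K i)) (x y : ∀ i, K i) :
    ∃ a b c : k, ∀ i, x i * y i =
      algebraMap k (K i) a * x i + algebraMap k (K i) b * y i + algebraMap k (K i) c := by
  obtain ⟨a, b, c, h⟩ := hq.exists_mul_eq x y
  exact ⟨a, b, c, congrFun h⟩

theorem eq_zero_or_eq_one_of_pi [∀ i, Nontrivial (K i)]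
    (hq : IsQuadraticExtension k (∀ i, K i)) {i j l : ι}
    (hij : i ≠ j) (hil : i ≠ l) (hjl : j ≠ l) (z : K i) : z = 0 ∨ z = 1 := by
  classical
  -- Compare the `i`, `j` and `l` coordinates of the product of `(z, 1, 0)` and `(0, 1, w)`.
  have key (w : k) : ∃ a b c : k, algebraMap k (K i) a * z + algebraMap k (K i) c = 0 ∧
      a + b + c = 1 ∧ b * w + c = 0 := by
    obtain ⟨a, b, c, h⟩ := hq.exists_mul_apply_eq (Pi.single i z + Pi.single j 1)
      (Pi.single j 1 + Pi.single l (algebraMap k (K l) w))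
    refine ⟨a, b, c, ?_, (algebraMap k (K j)).injective ?_, (algebraMap k (K l)).injective ?_⟩
    · simpa [hij, hil] using (h i).symm
    · simpa [hij.symm, hjl] using (h j).symm
    · simpa [hil.symm, hjl.symm] using (h l).symm
  obtain ⟨ζ, rfl⟩ : ∃ ζ : k, algebraMap k (K i) ζ = z := by
    obtain ⟨a, b, c, hi, hj, hl⟩ := key 1
    obtain rfl : a = 1 := by linear_combination hj - hl
    exact ⟨-c, by rw [map_neg]; linear_combination z * map_one (algebraMap k (K i)) - hi⟩
  by_contra! hζ
  have hζ0 : ζ ≠ 0 := by rintro rfl; simp at hζ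
  have hζ1 : ζ - 1 ≠ 0 := fun h => hζ.2 (by rw [sub_eq_zero.1 h, map_one])
  obtain ⟨a, b, c, hi, hj, hl⟩ := key (ζ / (ζ - 1))
  rw [← map_mul, ← map_add, map_eq_zero_iff _ (algebraMap k (K i)).injective] at hi
  field_simp at hl
  refine mul_ne_zero hζ0 hζ1 ?_
  linear_combination (ζ - 1) * hi + (ζ - 1) * hl - ζ * (ζ - 1) * hj

theorem isEmpty_fin_four_embedding_of_pi [∀ i, Nontrivial (K i)]
    (hq : IsQuadraticExtension k (∀ i, K i)) : IsEmpty (Fin 4 ↪ ι) := by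
  classical
  refine ⟨fun e => ?_⟩
  have hne {s t : Fin 4} (h : s ≠ t) : e s ≠ e t := e.injective.ne h
  obtain ⟨a, b, c, h⟩ := hq.exists_mul_apply_eq (Pi.single (e 0) 1 + Pi.single (e 1) 1)
    (Pi.single (e 0) 1 + Pi.single (e 2) 1)
  have h0 : a + b + c = 1 := (algebraMap k (K (e 0))).injective <| by
    simpa [hne] using (h (e 0)).symm
  have h1 : a + c = 0 := (algebraMap k (K (e 1))).injective <| by
    simpa [hne] using (h (e 1)).symm
  have h2 : b + c = 0 := (algebraMap k (K (e 2))).injective <| by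
    simpa [hne] using (h (e 2)).symm
  have h3 : c = 0 := (algebraMap k (K (e 3))).injective <| by
    simpa [hne] using (h (e 3)).symm
  exact one_ne_zero (by linear_combination h1 + h2 - h0 - h3 : (1 : k) = 0)

end Pi

end IsQuadraticExtension

theorem isUnit_sub_of_mem_jacobson_bot {x u : C} (hx : x ∈ Ideal.jacobson (⊥ : Ideal C))
    (hu : IsUnit u) : IsUnit (x - u) := by
  obtain ⟨u, rfl⟩ := hu
  convert u.isUnit.mul (Ideal.mem_jacobson_bot.1 (neg_mem hx) (↑u⁻¹)).neg using 1
  linear_combination -x * u.mul_inv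

theorem jacobson_bot_le_of_isMaximal (P : Ideal C) [hP : P.IsMaximal] :
    Ideal.jacobson (⊥ : Ideal C) ≤ P :=
  sInf_le ⟨bot_le, hP⟩

theorem exists_forall_sub_mem_asIdeal {ι : Type*} [Finite ι] {P : ι → MaximalSpectrum C}
    (hP : Function.Injective P) (a : ι → C) : ∃ x, ∀ i, x - a i ∈ (P i).asIdeal :=
  Ideal.exists_forall_sub_mem_ideal
    (fun _ _ hij => MaximalSpectrum.isCoprime_of_ne (hP.ne hij)) a

section IsLocalRing

variable [IsLocalRing R]

theorem liesOver_maximalIdeal [Algebra.IsIntegral R C] (P : Ideal C) [P.IsMaximal] :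
    P.LiesOver (maximalIdeal R) :=
  ⟨(eq_maximalIdeal (Ideal.isMaximal_comap_of_isIntegral_of_isMaximal P)).symm⟩

theorem algebraMap_mem_iff_mem_maximalIdeal [Algebra.IsIntegral R C] (P : Ideal C) [P.IsMaximal]
    {r : R} : algebraMap R C r ∈ P ↔ r ∈ maximalIdeal R :=
  have := liesOver_maximalIdeal (R := R) P
  (Ideal.mem_of_liesOver P (maximalIdeal R) r).symm

theorem mem_maximalIdeal_of_algebraMap_mem_jacobson_bot [Nontrivial C] {r : R}
    (hr : algebraMap R C r ∈ Ideal.jacobson (⊥ : Ideal C)) : r ∈ maximalIdeal R := fun h =>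
  bot_ne_top <| Ideal.jacobson_eq_top_iff.1 <|
    Ideal.eq_top_of_isUnit_mem _ hr (h.map (algebraMap R C))

theorem map_maximalIdeal_le_jacobson_bot [Algebra.IsIntegral R C] :
    (maximalIdeal R).map (algebraMap R C) ≤ Ideal.jacobson ⊥ :=
  le_sInf fun P hP => Ideal.map_le_iff_le_comap.2 fun _ hr =>
    have := hP.2
    (algebraMap_mem_iff_mem_maximalIdeal P).2 hr

namespace IsQuadraticExtension

theorem isEmpty_fin_four_embedding (hq : IsQuadraticExtension R C) :
    IsEmpty (Fin 4 ↪ MaximalSpectrum C) := by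
  refine ⟨fun P => ?_⟩
  have := hq.isIntegral
  have (i : Fin 4) := liesOver_maximalIdeal (R := R) (P i).asIdeal
  let : Field (R ⧸ maximalIdeal R) := Ideal.Quotient.field _
  exact (hq.pi_quotient (maximalIdeal R) (fun i => (P i).asIdeal) fun _ _ hij =>
    MaximalSpectrum.isCoprime_of_ne (P.injective.ne hij)).isEmpty_fin_four_embedding_of_pi.elim
      (Function.Embedding.refl _)

theorem finite_maximalSpectrum (hq : IsQuadraticExtension R C) : Finite (MaximalSpectrum C) := by
  by_contra h
  have := not_finite_iff_infinite.1 h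
  exact hq.isEmpty_fin_four_embedding.elim (Fin.valEmbedding.trans (Infinite.natEmbedding _))

theorem bijective_fin_three_embedding (hq : IsQuadraticExtension R C)
    (P : Fin 3 ↪ MaximalSpectrum C) : Function.Bijective P := by
  refine ⟨P.injective, fun N => ?_⟩
  by_contra hN
  exact hq.isEmpty_fin_four_embedding.elim
    ⟨Fin.cons N P, Fin.cons_injective_iff.2 ⟨hN, P.injective⟩⟩

theorem mem_or_sub_one_mem (hq : IsQuadraticExtension R C) (P : Fin 3 ↪ MaximalSpectrum C)
    (N : Ideal C) [hN : N.IsMaximal] (z : C) : z ∈ N ∨ z - 1 ∈ N := by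
  have := hq.isIntegral
  obtain ⟨i, hi⟩ := (hq.bijective_fin_three_embedding P).2 ⟨N, hN⟩
  obtain rfl : (P i).asIdeal = N := by rw [hi]
  have (i : Fin 3) := liesOver_maximalIdeal (R := R) (P i).asIdeal
  let : Field (R ⧸ maximalIdeal R) := Ideal.Quotient.field _
  have hpi := hq.pi_quotient (maximalIdeal R) (fun i => (P i).asIdeal) fun _ _ hij =>
    MaximalSpectrum.isCoprime_of_ne (P.injective.ne hij)
  obtain ⟨j, l, hij, hil, hjl⟩ : ∃ j l, i ≠ j ∧ i ≠ l ∧ j ≠ l :=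
    (by decide : ∀ i : Fin 3, ∃ j l, i ≠ j ∧ i ≠ l ∧ j ≠ l) i
  simpa only [Ideal.Quotient.eq_zero_iff_mem, ← map_one (Ideal.Quotient.mk _), Ideal.Quotient.eq]
    using hpi.eq_zero_or_eq_one_of_pi hij hil hjl (Ideal.Quotient.mk _ z)

theorem exists_sq_sub_self_eq (hq : IsQuadraticExtension R C) (P P' : Ideal C) [P.IsMaximal]
    [P'.IsMaximal] {x : C} (hx : x - 1 ∈ P) (hx' : x ∈ P') :
    ∃ r ∈ maximalIdeal R, ∃ s ∈ maximalIdeal R,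
      x ^ 2 - x = algebraMap R C r * x + algebraMap R C s := by
  have := hq.isIntegral
  obtain ⟨a, s, h⟩ := hq.exists_sq_eq x
  have hs : s ∈ maximalIdeal R := by
    rw [← algebraMap_mem_iff_mem_maximalIdeal P',
      show algebraMap R C s = (x - algebraMap R C a) * x by linear_combination -h]
    exact P'.mul_mem_left _ hx'
  have ha : a - 1 + s ∈ maximalIdeal R := by
    rw [← algebraMap_mem_iff_mem_maximalIdeal P, show algebraMap R C (a - 1 + s) =
      (x + 1 - algebraMap R C a) * (x - 1) by
        simp only [map_add, map_sub, map_one]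
        linear_combination -h]
    exact P.mul_mem_left _ hx
  refine ⟨a - 1, ((maximalIdeal R).add_mem_iff_left hs).1 ha, s, hs, ?_⟩
  rw [map_sub, map_one]
  linear_combination h

theorem sq_mem_map_maximalIdeal [Nontrivial C] (hq : IsQuadraticExtension R C) {x : C}
    (hx : x ∈ Ideal.jacobson (⊥ : Ideal C)) : x ^ 2 ∈ (maximalIdeal R).map (algebraMap R C) := by
  obtain ⟨a, c, h⟩ := hq.exists_sq_eq x
  have hfac : (x - algebraMap R C a) * x = algebraMap R C c := by linear_combination h
  have hc : c ∈ maximalIdeal R :=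
    mem_maximalIdeal_of_algebraMap_mem_jacobson_bot (hfac ▸ Ideal.mul_mem_left _ _ hx)
  by_cases ha : IsUnit a
  · rw [sq]
    exact Ideal.mul_mem_left _ _ <| (Ideal.unit_mul_mem_iff_mem _
      (isUnit_sub_of_mem_jacobson_bot hx (ha.map (algebraMap R C)))).1
      (hfac ▸ Ideal.mem_map_of_mem _ hc)
  · rw [h]
    exact add_mem (Ideal.mul_mem_right _ _ (Ideal.mem_map_of_mem _ ((mem_maximalIdeal a).2 ha)))
      (Ideal.mem_map_of_mem _ hc)

theorem mul_mem_map_maximalIdeal [Nontrivial C] (hq : IsQuadraticExtension R C) {x y : C}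
    (hx : x ∈ Ideal.jacobson (⊥ : Ideal C)) (hy : y ∈ Ideal.jacobson (⊥ : Ideal C)) :
    x * y ∈ (maximalIdeal R).map (algebraMap R C) := by
  obtain ⟨a, b, c, h⟩ := hq.exists_mul_eq x y
  have hc : c ∈ maximalIdeal R := by
    refine mem_maximalIdeal_of_algebraMap_mem_jacobson_bot (C := C) ?_
    rw [show algebraMap R C c = (y - algebraMap R C a) * x - algebraMap R C b * y by
      linear_combination -h]
    exact sub_mem (Ideal.mul_mem_left _ _ hx) (Ideal.mul_mem_left _ _ hy)
  have hM {r : R} (hr : r ∈ maximalIdeal R) (z : C) :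
      algebraMap R C r * z ∈ (maximalIdeal R).map (algebraMap R C) :=
    Ideal.mul_mem_right _ _ (Ideal.mem_map_of_mem _ hr)
  by_cases ha : IsUnit a
  · rw [← Ideal.unit_mul_mem_iff_mem _
      (isUnit_sub_of_mem_jacobson_bot hy (ha.map (algebraMap R C))),
      show (y - algebraMap R C a) * (x * y) =
        algebraMap R C b * y ^ 2 + algebraMap R C c * y by linear_combination y * h]
    exact add_mem (Ideal.mul_mem_left _ _ (hq.sq_mem_map_maximalIdeal hy)) (hM hc y)
  by_cases hb : IsUnit b
  · rw [← Ideal.unit_mul_mem_iff_mem _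
      (isUnit_sub_of_mem_jacobson_bot hx (hb.map (algebraMap R C))),
      show (x - algebraMap R C b) * (x * y) =
        algebraMap R C a * x ^ 2 + algebraMap R C c * x by linear_combination x * h]
    exact add_mem (Ideal.mul_mem_left _ _ (hq.sq_mem_map_maximalIdeal hx)) (hM hc x)
  rw [h]
  exact add_mem (add_mem (hM ((mem_maximalIdeal a).2 ha) x) (hM ((mem_maximalIdeal b).2 hb) y))
    (Ideal.mem_map_of_mem _ hc)

theorem jacobson_bot_eq_map_maximalIdeal (hq : IsQuadraticExtension R C)
    {P P' : MaximalSpectrum C} (hne : P ≠ P') :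
    Ideal.jacobson (⊥ : Ideal C) = (maximalIdeal R).map (algebraMap R C) := by
  have := hq.isIntegral
  refine le_antisymm (fun n hn => ?_) map_maximalIdeal_le_jacobson_bot
  set MC := (maximalIdeal R).map (algebraMap R C)
  have hsq {x : C} (hx : x - 1 ∈ P.asIdeal) (hx' : x ∈ P'.asIdeal) : x ^ 2 - x ∈ MC := by
    obtain ⟨r, hr, s, hs, h⟩ := hq.exists_sq_sub_self_eq P.asIdeal P'.asIdeal hx hx'
    rw [h]
    exact MC.add_mem (MC.mul_mem_right _ (Ideal.mem_map_of_mem _ hr)) (Ideal.mem_map_of_mem _ hs)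
  obtain ⟨f, hf, e, he', hfe⟩ := Submodule.mem_sup.1 <| (Ideal.eq_top_iff_one _).1 <|
    Ideal.isCoprime_iff_sup_eq.1 (MaximalSpectrum.isCoprime_of_ne hne)
  have he : e - 1 ∈ P.asIdeal := by simpa [← hfe] using hf
  have hesq := hsq he he'
  have hensq : (e + n) ^ 2 - (e + n) ∈ MC := hsq
    (by rw [add_sub_right_comm]; exact add_mem he (jacobson_bot_le_of_isMaximal _ hn))
    (P'.asIdeal.add_mem he' (jacobson_bot_le_of_isMaximal _ hn))
  have hunit : IsUnit ((2 * e - 1 + n) * (2 * e - 1 + n)) := by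
    refine Ideal.isUnit_of_sub_one_mem_jacobson_bot _ ?_
    rw [show (2 * e - 1 + n) * (2 * e - 1 + n) - 1 =
      4 * (e ^ 2 - e) + (2 * (2 * e - 1) + n) * n by ring]
    exact add_mem (Ideal.mul_mem_left _ _ (map_maximalIdeal_le_jacobson_bot hesq))
      (Ideal.mul_mem_left _ _ hn)
  rw [← Ideal.unit_mul_mem_iff_mem MC (isUnit_of_mul_isUnit_left hunit),
    show (2 * e - 1 + n) * n = (e + n) ^ 2 - (e + n) - (e ^ 2 - e) by ring]
  exact MC.sub_mem hensq hesq

theorem exists_sq_sub_self_mem_jacobson_bot (hq : IsQuadraticExtension R C)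
    (P : Fin 3 ↪ MaximalSpectrum C) :
    ∃ e : C, e - 1 ∈ (P 0).asIdeal ∧ e ∈ (P 1).asIdeal ∧ e ∈ (P 2).asIdeal ∧
      e ^ 2 - e ∈ Ideal.jacobson (⊥ : Ideal C) := by
  obtain ⟨e, he⟩ := exists_forall_sub_mem_asIdeal P.injective ![1, 0, 0]
  have he0 : e - 1 ∈ (P 0).asIdeal := he 0
  have he1 : e ∈ (P 1).asIdeal := by simpa using he 1
  have he2 : e ∈ (P 2).asIdeal := by simpa using he 2
  refine ⟨e, he0, he1, he2, Submodule.mem_sInf.2 fun N hN => ?_⟩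
  obtain ⟨i, hi⟩ := (hq.bijective_fin_three_embedding P).2 ⟨N, hN.2⟩
  obtain rfl : (P i).asIdeal = N := by rw [hi]
  rw [show e ^ 2 - e = e * (e - 1) by ring]
  fin_cases i
  exacts [Ideal.mul_mem_left _ _ he0, Ideal.mul_mem_right _ _ he1, Ideal.mul_mem_right _ _ he2]

/- Let `e` lift the idempotent `(1, 0, 0)` of `C / Jac C`, the product of the three residue fields.
As `a` varies, the coefficient `s` in the quadratic equation of `e + m a` realizes, after division
by `m`, arbitrary residues at two of the maximal ideals. -/
theorem exists_mem_maximalIdeal_eq_mul (hq : IsQuadraticExtension R C)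
    (P : Fin 3 ↪ MaximalSpectrum C) {m : R} (hm : algebraMap R C m ∈ C⁰)
    (hspan : (maximalIdeal R).map (algebraMap R C) = Ideal.span {algebraMap R C m}) :
    ∃ s ∈ maximalIdeal R, ∃ y, algebraMap R C s = algebraMap R C m * y ∧
      y ∈ (P 1).asIdeal ∧ y + 1 ∈ (P 2).asIdeal := by
  have hdvd {r : R} (hr : r ∈ maximalIdeal R) : ∃ y, algebraMap R C r = algebraMap R C m * y :=
    Ideal.mem_span_singleton.1 (hspan ▸ Ideal.mem_map_of_mem _ hr)
  have hjac := hq.jacobson_bot_eq_map_maximalIdeal (P.injective.ne (by decide : (0 : Fin 3) ≠ 1))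
  rw [hspan] at hjac
  have hmP (i : Fin 3) : algebraMap R C m ∈ (P i).asIdeal :=
    jacobson_bot_le_of_isMaximal _ (hjac ▸ Ideal.mem_span_singleton_self _)
  obtain ⟨e, he0, he1, he2, he⟩ := hq.exists_sq_sub_self_mem_jacobson_bot P
  obtain ⟨f, hf⟩ := Ideal.mem_span_singleton.1 (hjac ▸ he)
  obtain ⟨a, ha⟩ := exists_forall_sub_mem_asIdeal P.injective ![0, f, f + 1]
  obtain ⟨r, hr, s, hs, hrs⟩ := hq.exists_sq_sub_self_eq (P 0).asIdeal (P 1).asIdeal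
    (x := e + algebraMap R C m * a)
    (by rw [add_sub_right_comm]; exact add_mem he0 (Ideal.mul_mem_right _ _ (hmP 0)))
    (add_mem he1 (Ideal.mul_mem_right _ _ (hmP 1)))
  obtain ⟨x, hx⟩ := hdvd hr
  obtain ⟨y, hy⟩ := hdvd hs
  have key : y = f - a + e * (2 * a - x) + algebraMap R C m * (a ^ 2 - x * a) := by
    refine (mul_cancel_left_mem_nonZeroDivisors hm).1 ?_
    linear_combination hf - hrs - (e + algebraMap R C m * a) * hx - hy
  refine ⟨s, hs, y, hy, ?_, ?_⟩
  · rw [key, ← neg_sub]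
    exact add_mem (add_mem (neg_mem (ha 1)) (Ideal.mul_mem_right _ _ he1))
      (Ideal.mul_mem_right _ _ (hmP 1))
  · rw [show y + 1 = -(a - (f + 1)) + e * (2 * a - x) + algebraMap R C m * (a ^ 2 - x * a) by
      rw [key]; ring]
    exact add_mem (add_mem (neg_mem (ha 2)) (Ideal.mul_mem_right _ _ he2))
      (Ideal.mul_mem_right _ _ (hmP 2))

end IsQuadraticExtension

end IsLocalRing

end QuadraticExtension

section MaximalSpectrum

theorem exists_forall_eq_or_eq_or_nonempty_fin_three_embedding (α : Type*) [Nonempty α] :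
    (∃ a b : α, ∀ x, x = a ∨ x = b) ∨ Nonempty (Fin 3 ↪ α) := by
  obtain ⟨a⟩ := ‹Nonempty α›
  by_cases hb : ∃ b, b ≠ a
  · obtain ⟨b, hba⟩ := hb
    by_cases hc : ∃ c, c ≠ a ∧ c ≠ b
    · obtain ⟨c, hca, hcb⟩ := hc
      refine .inr ⟨![a, b, c], fun i j => ?_⟩
      fin_cases i <;> fin_cases j <;> simp [hba, hca, hcb, hba.symm, hca.symm, hcb.symm]
    · push Not at hc
      exact .inl ⟨a, b, fun x => or_iff_not_imp_left.2 (hc x)⟩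
  · push Not at hb
    exact .inl ⟨a, a, fun x => .inl (hb x)⟩

variable {C : Type*} [CommRing C]

theorem ncard_setOf_isMaximal :
    {P : Ideal C | P.IsMaximal}.ncard = Nat.card (MaximalSpectrum C) :=
  Nat.card_congr (MaximalSpectrum.equivSubtype C).symm

theorem finite_setOf_isMaximal [Finite (MaximalSpectrum C)] : {P : Ideal C | P.IsMaximal}.Finite :=
  MaximalSpectrum.range_asIdeal (R := C) ▸ Set.finite_range _

theorem nonempty_quotient_ringEquiv_zmod_two_iff {P : Ideal C} [P.IsMaximal] :
    Nonempty (C ⧸ P ≃+* ZMod 2) ↔ ∀ z : C, z ∈ P ∨ z - 1 ∈ P := by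
  have h01 : (∀ z : C, z ∈ P ∨ z - 1 ∈ P) ↔ ∀ x : C ⧸ P, x = 0 ∨ x = 1 := by
    simp_rw [Ideal.Quotient.mk_surjective.forall, ← map_one (Ideal.Quotient.mk P),
      Ideal.Quotient.eq, Ideal.Quotient.eq_zero_iff_mem]
  rw [h01]
  constructor
  · rintro ⟨e⟩ x
    rw [← map_eq_zero_iff e e.injective, ← map_eq_one_iff e e.injective]
    exact (by decide : ∀ x : ZMod 2, x = 0 ∨ x = 1) (e x)
  · intro h
    have hcard : Nat.card (C ⧸ P) = 2 := Nat.card_eq_two_iff.2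
      ⟨0, 1, zero_ne_one, Set.eq_univ_of_forall h⟩
    have : Finite (C ⧸ P) := Nat.finite_of_card_ne_zero (by omega)
    have := Fintype.ofFinite (C ⧸ P)
    exact ⟨(ZMod.ringEquivOfPrime _ Nat.prime_two (by rw [← Nat.card_eq_fintype_card, hcard])).symm⟩

end MaximalSpectrum

section RegularPrincipal

variable {C : Type*} [CommRing C]

/-- The ideals generated by a single nonzerodivisor. -/
def IsRegularPrincipal (I : Ideal C) : Prop :=
  ∃ b ∈ C⁰, I = Ideal.span {b}

namespace IsRegularPrincipal

theorem isUnit_coeIdeal {I : Ideal C} (hI : IsRegularPrincipal I) :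
    IsUnit (I : FractionalIdeal C⁰ (FractionRing C)) := by
  obtain ⟨b, hb, rfl⟩ := hI
  rw [FractionalIdeal.coeIdeal_span_singleton]
  obtain ⟨u, hu⟩ := IsLocalization.map_units (FractionRing C) (⟨b, hb⟩ : C⁰)
  refine .of_mul_eq_one (FractionalIdeal.spanSingleton C⁰ ↑u⁻¹) ?_
  rw [FractionalIdeal.spanSingleton_mul_spanSingleton, ← hu, u.mul_inv,
    FractionalIdeal.spanSingleton_one]

theorem of_isPrincipal {I : Ideal C} (hI : I.IsPrincipal) (hreg : IsRegularIdeal I) :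
    IsRegularPrincipal I := by
  obtain ⟨b, rfl⟩ := hI.principal
  obtain ⟨_, hx, hxr⟩ := hreg
  obtain ⟨c, rfl⟩ := Ideal.mem_span_singleton.1 hx
  exact ⟨b, (mul_mem_nonZeroDivisors.1 hxr).1, rfl⟩

theorem of_mul_mem_nonZeroDivisors {J : Ideal C}
    {x y : C} (hy : y ∈ J) (hxy : x * y ∈ C⁰) (hdvd : ∀ z ∈ J, x * y ∣ x * z) :
    IsRegularPrincipal J := by
  obtain ⟨hx, hy'⟩ := mul_mem_nonZeroDivisors.1 hxy
  refine ⟨y, hy', le_antisymm (fun z hz => ?_) ((Ideal.span_singleton_le_iff_mem _).2 hy)⟩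
  obtain ⟨c, hc⟩ := hdvd z hz
  rw [mul_assoc, mul_cancel_left_mem_nonZeroDivisors hx] at hc
  exact Ideal.mem_span_singleton.2 ⟨c, hc⟩

theorem of_isUnit_coeIdeal [Finite (MaximalSpectrum C)] {I : Ideal C} (hreg : IsRegularIdeal I)
    (hI : IsUnit (I : FractionalIdeal C⁰ (FractionRing C))) : IsRegularPrincipal I :=
  of_isPrincipal (Ideal.IsPrincipal.of_finite_maximals_of_isUnit finite_setOf_isMaximal hI) hreg

theorem of_mul_le {P J K : Ideal C} [hP : P.IsMaximal] (hPs : IsRegularPrincipal P)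
    (hJ : ∀ K : Ideal C, J ≤ K → IsRegularPrincipal K) (hK : P * J ≤ K) :
    IsRegularPrincipal K := by
  by_cases hKP : K ≤ P
  · obtain ⟨p, hp, rfl⟩ := hPs
    obtain ⟨b, hb, hb'⟩ := hJ (Submodule.comap (LinearMap.mulLeft C p) K) fun x hx =>
      hK (Ideal.mul_mem_mul (Ideal.mem_span_singleton_self p) hx)
    have hmem (y : C) : p * y ∈ K ↔ b ∣ y := by
      rw [← Ideal.mem_span_singleton, ← hb']
      rfl
    refine ⟨p * b, mul_mem hp hb, le_antisymm (fun x hx => ?_) ?_⟩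
    · obtain ⟨y, rfl⟩ := Ideal.mem_span_singleton.1 (hKP hx)
      exact Ideal.mem_span_singleton.2 (mul_dvd_mul_left p ((hmem y).1 hx))
    · exact (Ideal.span_singleton_le_iff_mem K).2 ((hmem b).2 dvd_rfl)
  · refine hJ K fun x hx => ?_
    obtain ⟨k, hk, p, hp, hkp⟩ := Submodule.mem_sup.1 <|
      (Ideal.eq_top_iff_one _).1 (hP.out.2 (K ⊔ P) (right_lt_sup.2 hKP))
    rw [← one_mul x, ← hkp, add_mul]
    exact K.add_mem (K.mul_mem_right _ hk) (hK (Ideal.mul_mem_mul hp hx))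

theorem of_multiset_prod_le {s : Multiset (Ideal C)} (hs : ∀ P ∈ s, P.IsMaximal)
    (hs' : ∀ P ∈ s, IsRegularPrincipal P) {K : Ideal C} (hK : s.prod ≤ K) :
    IsRegularPrincipal K := by
  induction s using Multiset.induction generalizing K with
  | empty => exact ⟨1, one_mem _, by simpa using hK⟩
  | cons P s ih =>
    simp only [Multiset.forall_mem_cons] at hs hs'
    have := hs.1
    rw [Multiset.prod_cons] at hK
    exact of_mul_le hs'.1 (fun K hK => ih hs.2 hs'.2 hK) hK

end IsRegularPrincipal

theorem IsDedekindWithZeroDivisors.isRegularPrincipal [Finite (MaximalSpectrum C)]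
    (h : IsDedekindWithZeroDivisors C) {I : Ideal C} (hI : IsRegularIdeal I) :
    IsRegularPrincipal I :=
  .of_isUnit_coeIdeal hI (h I hI)

theorem jacobson_bot_eq_prod [Fintype (MaximalSpectrum C)] :
    Ideal.jacobson (⊥ : Ideal C) = ∏ P : MaximalSpectrum C, P.asIdeal := by
  rw [Ideal.prod_eq_iInf_of_pairwise_isCoprime fun _ _ _ _ => MaximalSpectrum.isCoprime_of_ne]
  refine le_antisymm (le_iInf₂ fun P _ => jacobson_bot_le_of_isMaximal P.asIdeal) ?_
  exact le_sInf fun P hP => iInf₂_le (⟨P, hP.2⟩ : MaximalSpectrum C) (Finset.mem_univ _)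

theorem IsRegularPrincipal.of_isMaximal [Finite (MaximalSpectrum C)]
    (hjac : IsRegularPrincipal (Ideal.jacobson (⊥ : Ideal C))) (P : Ideal C) [hP : P.IsMaximal] :
    IsRegularPrincipal P := by
  classical
  have := Fintype.ofFinite (MaximalSpectrum C)
  have hu := hjac.isUnit_coeIdeal
  rw [jacobson_bot_eq_prod, ← Finset.mul_prod_erase _ _ (Finset.mem_univ ⟨P, hP⟩),
    FractionalIdeal.coeIdeal_mul] at hu
  obtain ⟨j, hj, hjac⟩ := hjac
  refine .of_isUnit_coeIdeal ⟨j, jacobson_bot_le_of_isMaximal P ?_, hj⟩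
    (isUnit_of_mul_isUnit_left hu)
  exact hjac ▸ Ideal.mem_span_singleton_self j

theorem exists_map_eq_span_algebraMap {R : Type*} [CommRing R] [Algebra R C]
    {I : Ideal R} (hI : IsRegularPrincipal (I.map (algebraMap R C))) {P P' : MaximalSpectrum C}
    (hP : ∀ N, N = P ∨ N = P') :
    ∃ i ∈ I, I.map (algebraMap R C) = Ideal.span {algebraMap R C i} := by
  obtain ⟨b, hb, hspan⟩ := hI
  have hnle (N : MaximalSpectrum C) :
      ¬I ≤ (Ideal.span {b} * N.asIdeal).comap (algebraMap R C) := by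
    rw [← Ideal.map_le_iff_le_comap, hspan, Ideal.span_singleton_le_iff_mem,
      Ideal.mem_span_singleton_mul]
    rintro ⟨v, hv, hbv⟩
    obtain rfl : v = 1 := (mul_cancel_left_mem_nonZeroDivisors hb).1 (hbv.trans (mul_one b).symm)
    exact N.2.ne_top ((Ideal.eq_top_iff_one _).2 hv)
  obtain ⟨i, hi, hiP⟩ : ∃ i ∈ I, ∀ N : MaximalSpectrum C,
      algebraMap R C i ∉ Ideal.span {b} * N.asIdeal := by
    have h := mt Ideal.subset_union.1 (not_or.2 ⟨hnle P, hnle P'⟩)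
    obtain ⟨i, hi, hiP⟩ := Set.not_subset.1 h
    refine ⟨i, hi, fun N hN => hiP ?_⟩
    rcases hP N with rfl | rfl
    exacts [.inl hN, .inr hN]
  refine ⟨i, hi, ?_⟩
  obtain ⟨v, hv⟩ := Ideal.mem_span_singleton.1 (hspan ▸ Ideal.mem_map_of_mem (algebraMap R C) hi)
  have hvu : IsUnit v := by
    by_contra hn
    obtain ⟨N, hN, hvN⟩ := exists_max_ideal_of_mem_nonunits hn
    exact hiP ⟨N, hN⟩ (Ideal.mem_span_singleton_mul.2 ⟨v, hvN, hv.symm⟩)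
  rw [hspan, hv, Ideal.span_singleton_mul_right_unit hvu]

end RegularPrincipal

section Dimension

variable {C : Type*} [CommRing C]

theorem krullDimLE_one_of_isIntegral (R : Type*) [CommRing R] [Algebra R C]
    [Algebra.IsIntegral R C] [Ring.KrullDimLE 1 R] : Ring.KrullDimLE 1 C := by
  refine Ring.krullDimLE_one_iff.2 fun P hP => or_iff_not_imp_left.2 fun hmin => ?_
  obtain ⟨Q, hQ, hQP⟩ := Ideal.exists_minimalPrimes_le (bot_le (a := P))
  have := Ideal.IsMinimalPrime.isPrime hQ
  have hlt : Q.comap (algebraMap R C) < P.comap (algebraMap R C) :=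
    Ideal.IsIntegral.comap_lt_comap (hQP.lt_of_ne fun h => hmin (h ▸ hQ))
  refine Ideal.isMaximal_of_isIntegral_of_isMaximal_comap (R := R) P ?_
  refine (Ring.krullDimLE_one_iff.1 ‹_› _ (Ideal.comap_isPrime _ P)).resolve_left fun h => ?_
  exact hlt.not_ge (h.2 ⟨Ideal.comap_isPrime _ Q, bot_le⟩ hlt.le)

theorem isMaximal_of_mem_nonZeroDivisors [Ring.KrullDimLE 1 C] {P : Ideal C} [hP : P.IsPrime]
    {x : C} (hx : x ∈ C⁰) (hxP : x ∈ P) : P.IsMaximal :=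
  (Ring.krullDimLE_one_iff.1 ‹_› P hP).resolve_left fun h =>
    notMem_nonZeroDivisors_of_mem_mem_minimalPrimes hxP h hx

theorem jacobson_bot_le_radical [Ring.KrullDimLE 1 C] {K : Ideal C} (hK : IsRegularIdeal K) :
    Ideal.jacobson ⊥ ≤ K.radical := by
  obtain ⟨y, hy, hyr⟩ := hK
  rw [Ideal.radical_eq_sInf]
  refine le_sInf fun P ⟨hKP, hP⟩ => ?_
  have := isMaximal_of_mem_nonZeroDivisors hyr (hKP hy)
  exact jacobson_bot_le_of_isMaximal P

theorem IsRegularPrincipal.of_isRegularIdeal [Finite (MaximalSpectrum C)] [Ring.KrullDimLE 1 C]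
    (hjac : IsRegularPrincipal (Ideal.jacobson (⊥ : Ideal C))) {K : Ideal C}
    (hK : IsRegularIdeal K) : IsRegularPrincipal K := by
  have := Fintype.ofFinite (MaximalSpectrum C)
  obtain ⟨n, hn⟩ : ∃ n, Ideal.jacobson (⊥ : Ideal C) ^ n ≤ K := by
    refine Ideal.exists_pow_le_of_le_radical_of_fg (jacobson_bot_le_radical hK) ?_
    obtain ⟨j, -, hj⟩ := hjac
    exact ⟨{j}, by simp [hj]⟩
  have hs : ∀ P ∈ n • Finset.univ.val.map (MaximalSpectrum.asIdeal (R := C)), P.IsMaximal := by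
    intro P hP
    obtain ⟨P, -, rfl⟩ := Multiset.mem_map.1 (Multiset.mem_of_mem_nsmul hP)
    exact P.isMaximal
  refine of_multiset_prod_le hs (fun P hP => ?_) (by rwa [Multiset.prod_nsmul, ← Finset.prod,
    ← jacobson_bot_eq_prod])
  have := hs P hP
  exact hjac.of_isMaximal P

theorem exists_notMem_mul_eq_zero [Ring.KrullDimLE 0 C] {I P : Ideal C} [P.IsPrime] (hI : I.FG)
    (hIP : I ≤ P) {d : C} (hdI : ∀ n, d ∈ I ^ n) : ∃ s ∉ P, s * d = 0 := by
  let L := Localization.AtPrime P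
  have : Ring.KrullDimLE 0 L :=
    .of_isLocalization P (Ideal.mem_minimalPrimes_of_krullDimLE_zero P) L
  obtain ⟨n, hn⟩ : IsNilpotent (I.map (algebraMap C L)) := by
    rw [Ideal.FG.isNilpotent_iff_le_nilradical (hI.map _),
      Ring.KrullDimLE.nilradical_eq_maximalIdeal]
    exact (Ideal.map_mono hIP).trans_eq Localization.AtPrime.map_eq_maximalIdeal
  have hd : algebraMap C L d = 0 := by
    have := Ideal.mem_map_of_mem (algebraMap C L) (hdI n)
    rwa [Ideal.map_pow, hn] at this
  obtain ⟨s, hs⟩ := (IsLocalization.map_eq_zero_iff P.primeCompl L d).1 hd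
  exact ⟨s, s.2, hs⟩

theorem krullDimLE_zero_quotient [Ring.KrullDimLE 1 C] {I : Ideal C} (hI : IsRegularIdeal I) :
    Ring.KrullDimLE 0 (C ⧸ I) := by
  obtain ⟨x, hx, hxr⟩ := hI
  refine Ideal.krullDimLE_zero_quotient_iff_forall_minimalPrimes_isMaximal.2 fun P hP => ?_
  have := hP.1.1
  exact isMaximal_of_mem_nonZeroDivisors hxr (hP.1.2 hx)

theorem eq_top_of_forall_mem_pow [Ring.KrullDimLE 1 C] {I : Ideal C} (hI : I.FG) {d : C}
    (hd : d ∈ C⁰) (hdI : ∀ n, d ∈ I ^ n) : I = ⊤ := by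
  by_contra hne
  obtain ⟨P, hP, hIP⟩ := Ideal.exists_le_maximal I hne
  have hdI1 : d ∈ I := by simpa only [pow_one] using hdI 1
  set K : Ideal C := Ideal.span {d ^ 2} with hK
  have hKP : K ≤ P :=
    (Ideal.span_singleton_le_iff_mem P).2 (Ideal.pow_mem_of_mem P (hIP hdI1) 2 two_pos)
  have : Ring.KrullDimLE 0 (C ⧸ K) :=
    krullDimLE_zero_quotient ⟨_, Ideal.mem_span_singleton_self _, pow_mem hd 2⟩
  have : (P.map (Ideal.Quotient.mk K)).IsPrime :=
    Ideal.map_isPrime_of_surjective Ideal.Quotient.mk_surjective (by rwa [Ideal.mk_ker])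
  obtain ⟨s, hsP, hs⟩ := exists_notMem_mul_eq_zero (hI.map (Ideal.Quotient.mk K))
    (Ideal.map_mono hIP) (d := Ideal.Quotient.mk K d) fun n => by
      rw [← Ideal.map_pow]
      exact Ideal.mem_map_of_mem _ (hdI n)
  obtain ⟨s, rfl⟩ := Ideal.Quotient.mk_surjective s
  rw [← map_mul, Ideal.Quotient.eq_zero_iff_mem, hK, Ideal.mem_span_singleton, sq,
    dvd_cancel_right_mem_nonZeroDivisors hd] at hs
  exact hsP (Ideal.mem_map_of_mem _ (P.mem_of_dvd hs (hIP hdI1)))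

end Dimension

section Tower

variable {R Q : Type*} [CommRing R] [CommRing Q] [Algebra R Q]

theorem mem_jac {C : Subalgebra R Q} {q : Q} :
    q ∈ jac C ↔ ∃ x ∈ Ideal.jacobson (⊥ : Ideal C), (x : Q) = q := Iff.rfl

theorem coe_mem_jac {C : Subalgebra R Q} {x : C} :
    (x : Q) ∈ jac C ↔ x ∈ Ideal.jacobson (⊥ : Ideal C) :=
  Subtype.val_injective.mem_set_image

theorem mem_of_mem_jac {C : Subalgebra R Q} {q : Q} (hq : q ∈ jac C) : q ∈ C := by
  obtain ⟨x, -, rfl⟩ := hq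
  exact x.2

theorem le_endRing_jac (C : Subalgebra R Q) : C ≤ endRing (jac C) := by
  rintro c hc _ ⟨x, hx, rfl⟩
  exact coe_mem_jac.2 (Ideal.mul_mem_left _ (⟨c, hc⟩ : C) hx)

theorem jac_bot [IsLocalRing R] [Nontrivial Q] :
    jac (⊥ : Subalgebra R Q) = IsLocalization.coeSubmodule Q (maximalIdeal R) := by
  ext q
  constructor
  · rintro ⟨x, hx, rfl⟩
    obtain ⟨r, hr⟩ := Algebra.mem_bot.1 x.2
    obtain rfl : algebraMap R (⊥ : Subalgebra R Q) r = x := Subtype.ext hr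
    exact ⟨r, mem_maximalIdeal_of_algebraMap_mem_jacobson_bot hx, rfl⟩
  · rintro ⟨r, hr, rfl⟩
    exact coe_mem_jac (x := algebraMap R (⊥ : Subalgebra R Q) r).2
      (map_maximalIdeal_le_jacobson_bot (Ideal.mem_map_of_mem _ hr))

variable (R Q) in
theorem tower_monotone : Monotone (tower R Q) :=
  monotone_nat_of_le_succ fun n => le_endRing_jac (tower R Q n)

variable (R Q) in
theorem tower_le_towerTop (n : ℕ) : tower R Q n ≤ towerTop R Q := le_iSup _ n

theorem mem_towerTop {q : Q} : q ∈ towerTop R Q ↔ ∃ n, q ∈ tower R Q n := by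
  rw [← SetLike.mem_coe, towerTop,
    Subalgebra.coe_iSup_of_directed (tower_monotone R Q).directed_le, Set.mem_iUnion]
  rfl

theorem towerTop_eq_of_endRing_eq {n : ℕ} (h : endRing (jac (tower R Q n)) = tower R Q n) :
    towerTop R Q = tower R Q n := by
  have hle (k : ℕ) : tower R Q (n + k) = tower R Q n := by
    induction k with
    | zero => rfl
    | succ k ih => rw [← add_assoc, tower, ih, h]
  refine le_antisymm (fun q hq => ?_) (tower_le_towerTop R Q n)
  obtain ⟨k, hk⟩ := mem_towerTop.1 hq
  exact hle k ▸ tower_monotone R Q (Nat.le_add_left k n) hk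

theorem IsQuadraticExtension.of_le {C B : Subalgebra R Q} (hB : IsQuadraticExtension R B)
    (h : C ≤ B) : IsQuadraticExtension R C := by
  intro x y
  obtain ⟨a, b, c, habc⟩ := Submodule.mem_span_triple.1 (hB ⟨x, h x.2⟩ ⟨y, h y.2⟩)
  exact Submodule.mem_span_triple.2 ⟨a, b, c, by simpa [Subtype.ext_iff] using habc⟩

theorem mem_nonZeroDivisors_of_isUnit_coe {C : Subalgebra R Q} {c : C} (hc : IsUnit (c : Q)) :
    c ∈ C⁰ :=
  mem_nonZeroDivisors_of_injective (f := C.val) Subtype.val_injective hc.mem_nonZeroDivisors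

variable [IsFractionRing R Q]

theorem isUnit_algebraMap {r : R} (hr : r ∈ R⁰) : IsUnit (algebraMap R Q r) :=
  IsLocalization.map_units Q (⟨r, hr⟩ : R⁰)

theorem algebraMap_mem_nonZeroDivisors {r : R} (hr : r ∈ R⁰) (C : Subalgebra R Q) :
    algebraMap R C r ∈ C⁰ :=
  mem_nonZeroDivisors_of_isUnit_coe (isUnit_algebraMap hr)

variable (R) in
theorem algebraMap_subalgebra_injective (C : Subalgebra R Q) :
    Function.Injective (algebraMap R C) :=
  .of_comp (f := C.val) (IsFractionRing.injective R Q)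

theorem isUnit_coe_of_mem_nonZeroDivisors {C : Subalgebra R Q} {c : C} (hc : c ∈ C⁰) :
    IsUnit (c : Q) := by
  obtain ⟨⟨r, s⟩, hrs⟩ := IsLocalization.surj R⁰ (c : Q)
  have hr : algebraMap R C r = c * algebraMap R C s := Subtype.ext hrs.symm
  have hr' : r ∈ R⁰ := mem_nonZeroDivisors_of_injective (algebraMap_subalgebra_injective R C)
    (hr ▸ mul_mem hc (algebraMap_mem_nonZeroDivisors s.2 C))
  exact isUnit_of_mul_isUnit_left (hrs ▸ isUnit_algebraMap (Q := Q) hr')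

theorem isFractionRing_subalgebra (C : Subalgebra R Q) : IsFractionRing C Q := by
  refine (isLocalization_iff C⁰ Q).2 ⟨fun c => isUnit_coe_of_mem_nonZeroDivisors c.2, ?_, ?_⟩
  · intro q
    obtain ⟨⟨r, s⟩, hrs⟩ := IsLocalization.surj R⁰ q
    exact ⟨(algebraMap R C r, ⟨_, algebraMap_mem_nonZeroDivisors s.2 C⟩), hrs⟩
  · intro x y h
    exact ⟨1, by rw [Subtype.ext h]⟩

theorem endRing_jac_eq {C : Subalgebra R Q}
    (hC : IsRegularPrincipal (Ideal.jacobson (⊥ : Ideal C))) : endRing (jac C) = C := by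
  obtain ⟨j, hj, hjac⟩ := hC
  refine le_antisymm (fun q hq => ?_) (le_endRing_jac C)
  obtain ⟨x, hx, hxq⟩ := hq j (coe_mem_jac.2 (hjac ▸ Ideal.mem_span_singleton_self j))
  obtain ⟨c, rfl⟩ := Ideal.mem_span_singleton.1 (hjac ▸ hx : x ∈ Ideal.span {j})
  have hqc : (j : Q) * q = j * c := (mul_comm _ _).trans hxq.symm
  exact (isUnit_coe_of_mem_nonZeroDivisors hj).mul_left_cancel hqc ▸ c.2

theorem towerTop_eq_of_jac_eq_jac_bot {S : Subalgebra R Q}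
    (hjac : jac S = jac (⊥ : Subalgebra R Q))
    (hS : IsRegularPrincipal (Ideal.jacobson (⊥ : Ideal S))) : towerTop R Q = S := by
  have hend : endRing (jac S) = S := endRing_jac_eq hS
  have htower : tower R Q 1 = S := by rw [tower, tower, ← hjac, hend]
  exact htower ▸ towerTop_eq_of_endRing_eq (htower.symm ▸ hend)

end Tower

section Stable

variable {R : Type*} [CommRing R] {I : Ideal R}

theorem coe_end_mul_comm (f : Module.End R I) (a b : I) : (f a : R) * b = a * f b := by
  have hab : (b : R) • a = (a : R) • b := Subtype.ext (mul_comm _ _)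
  have h := congrArg (fun z : I => (z : R)) (congrArg f hab)
  simpa [mul_comm] using h

theorem coe_endLinearMap_mul_comm (φ : I →ₗ[Module.End R I] Module.End R I) (x y a b : I) :
    (x : R) * y * φ a b = a * b * φ x y := by
  have hxa : (x : R) • a = (a : R) • x := Subtype.ext (mul_comm _ _)
  have h : (x : R) * φ a y = a * φ x y := by
    simpa using congrArg (fun f : Module.End R I => (f y : R)) (congrArg φ hxa)
  linear_combination (b : R) * h - x * coe_end_mul_comm (φ a) y b

theorem isStableIdeal_of_forall_mul {i : R} (hi : i ∈ I) (hreg : i ∈ R⁰)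
    (h : ∀ a ∈ I, ∀ b ∈ I, ∃ c ∈ I, a * b = i * c) : IsStableIdeal I := by
  have hcancel {x y : R} (hxy : i * x = i * y) : x = y :=
    (mul_cancel_left_mem_nonZeroDivisors hreg).1 hxy
  have hinj : Function.Injective (LinearMap.mulLeft R i ∘ₗ I.subtype) :=
    fun x y hxy => Subtype.ext (hcancel hxy)
  let e := LinearEquiv.ofInjective _ hinj
  let ev := LinearMap.toSpanSingleton (Module.End R I) I ⟨i, hi⟩
  refine Module.Projective.of_equiv (LinearEquiv.ofBijective ev ⟨fun f g hfg => ?_, fun a => ?_⟩)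
  · refine LinearMap.ext fun b => Subtype.ext (hcancel ?_)
    rw [← coe_end_mul_comm f ⟨i, hi⟩ b, ← coe_end_mul_comm g ⟨i, hi⟩ b]
    exact congrArg (fun z : I => (z : R) * b) hfg
  · let f : Module.End R I := e.symm ∘ₗ (LinearMap.mulLeft R (a : R) ∘ₗ I.subtype).codRestrict
      (LinearMap.mulLeft R i ∘ₗ I.subtype).range fun b => by
        obtain ⟨c, hc, habc⟩ := h a a.2 b b.2
        exact ⟨⟨c, hc⟩, habc.symm⟩
    have hf (b : I) : i * f b = a * b := congrArg Subtype.val (e.apply_symm_apply _)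
    exact ⟨f, Subtype.ext (hcancel ((hf ⟨i, hi⟩).trans (mul_comm _ _)))⟩

theorem isStableIdeal_of_map_eq_span {B : Type*} [CommRing B] [Algebra R B]
    (hinj : Function.Injective (algebraMap R B)) (hB : IsQuadraticExtension R B) {i : R}
    (hi : i ∈ I) (hreg : i ∈ R⁰) (h : I.map (algebraMap R B) = Ideal.span {algebraMap R B i}) :
    IsStableIdeal I := by
  have hdvd {a : R} (ha : a ∈ I) : algebraMap R B i ∣ algebraMap R B a :=
    Ideal.mem_span_singleton.1 (h ▸ Ideal.mem_map_of_mem _ ha)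
  refine isStableIdeal_of_forall_mul hi hreg fun a ha b hb => ?_
  obtain ⟨x, hx⟩ := hdvd ha
  obtain ⟨y, hy⟩ := hdvd hb
  obtain ⟨α, β, γ, hxy⟩ := hB.exists_mul_eq x y
  refine ⟨α * a + β * b + γ * i, add_mem (add_mem (I.mul_mem_left _ ha) (I.mul_mem_left _ hb))
    (I.mul_mem_left _ hi), hinj ?_⟩
  simp only [map_mul, map_add]
  rw [hx, hy]
  linear_combination algebraMap R B i ^ 2 * hxy

variable {Q : Type*} [CommRing Q] [Algebra R Q]

theorem IsStableIdeal.one_mem_mul_div [IsFractionRing R Q] (hI : IsStableIdeal I)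
    (hreg : IsRegularIdeal I) :
    (1 : Q) ∈ IsLocalization.coeSubmodule Q I * (IsLocalization.coeSubmodule Q I /
      (IsLocalization.coeSubmodule Q I * IsLocalization.coeSubmodule Q I)) := by
  obtain ⟨x, hx, hxr⟩ := hreg
  lift x to I using hx
  obtain ⟨u, hu⟩ := isUnit_algebraMap (Q := Q) hxr
  obtain ⟨σ, hσ⟩ := Module.projective_def'.1 hI
  let φ (v : I) : I →ₗ[Module.End R I] Module.End R I := Finsupp.lapply v ∘ₗ σ
  have hx : ∑ v ∈ (σ x).support, (φ v x v : R) = x := by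
    have := LinearMap.congr_fun hσ x
    simpa [Finsupp.linearCombination_apply, Finsupp.sum, φ] using congrArg Subtype.val this
  have hone : ∑ v ∈ (σ x).support,
      algebraMap R Q v * (algebraMap R Q (φ v x x) * (↑u⁻¹ * ↑u⁻¹)) = 1 := by
    have hv (v : I) : algebraMap R Q v * (algebraMap R Q (φ v x x) * (↑u⁻¹ * ↑u⁻¹)) =
        algebraMap R Q (φ v x v) * ↑u⁻¹ := by
      have h := congrArg (algebraMap R Q) (coe_end_mul_comm (φ v x) x v)
      rw [map_mul, map_mul, ← hu] at h
      linear_combination (↑u⁻¹ : Q) ^ 2 * h + algebraMap R Q (φ v x v) * ↑u⁻¹ * u.mul_inv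
    rw [Finset.sum_congr rfl fun v _ => hv v, ← Finset.sum_mul, ← map_sum, hx, ← hu, u.mul_inv]
  rw [← hone]
  refine sum_mem fun v _ => Submodule.mul_mem_mul ⟨v, v.2, rfl⟩ <|
    Submodule.mem_div_iff_forall_mul_mem.2 fun z hz => ?_
  refine Submodule.mul_induction_on hz ?_ fun _ _ h h' => by rw [mul_add]; exact add_mem h h'
  rintro _ ⟨a, ha, rfl⟩ _ ⟨b, hb, rfl⟩
  refine ⟨φ v ⟨a, ha⟩ ⟨b, hb⟩, Subtype.prop _, ?_⟩
  have h := congrArg (algebraMap R Q) (coe_endLinearMap_mul_comm (φ v) x x ⟨a, ha⟩ ⟨b, hb⟩)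
  simp only [map_mul, ← hu] at h
  simp only [Algebra.linearMap_apply]
  linear_combination (↑u⁻¹ : Q) ^ 2 * h -
    algebraMap R Q (φ v ⟨a, ha⟩ ⟨b, hb⟩) * (u * ↑u⁻¹ + 1) * u.mul_inv

theorem one_mem_mul_div_of_smul {J : Submodule R Q} (u : Qˣ)
    (h : 1 ∈ (u • J) * ((u • J) / ((u • J) * (u • J)))) : 1 ∈ J * (J / (J * J)) := by
  have hle : u • ((u • J) / ((u • J) * (u • J))) ≤ J / (J * J) := by
    rintro _ ⟨q, hq, rfl⟩
    refine Submodule.mem_div_iff_forall_mul_mem.2 fun z hz => ?_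
    have hz' : (u * u) • z ∈ (u • J) * (u • J) := by
      rw [smul_mul_smul_comm]
      exact Submodule.smul_mem_pointwise_smul _ _ _ hz
    obtain ⟨y, hy, hyz⟩ := Submodule.mem_div_iff_forall_mul_mem.1 hq _ hz'
    convert SetLike.mem_coe.1 hy
    refine smul_left_cancel u (Eq.trans ?_ hyz.symm)
    simp only [DistribSMul.toLinearMap_apply, Units.smul_def, smul_eq_mul, Units.val_mul]
    ring
  rw [smul_mul_assoc, ← mul_smul_comm] at h
  exact mul_le_mul_right hle J h

/-- The submodule `J` of `Q`, regarded as a module over its multiplier ring `E(J)`. -/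
def endModule (J : Submodule R Q) : Submodule (endRing J) Q where
  __ := J
  smul_mem' c _ hx := c.2 _ hx

theorem mem_endModule {J : Submodule R Q} {q : Q} : q ∈ endModule J ↔ q ∈ J := Iff.rfl

theorem isUnit_endModule {J : Submodule R Q} (h : 1 ∈ J * (J / (J * J))) :
    IsUnit (endModule J) := by
  refine .of_mul_eq_one (1 / endModule J) (le_antisymm Submodule.mul_one_div_le_one ?_)
  rw [Submodule.one_le]
  refine Submodule.mul_induction_on h (fun a ha q hq => ?_) fun _ _ => add_mem
  refine Submodule.mul_mem_mul ha (Submodule.mem_div_iff_forall_mul_mem.2 fun b hb => ?_)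
  refine Submodule.mem_one.2 ⟨⟨q * b, fun c hc => ?_⟩, rfl⟩
  rw [mul_assoc]
  exact Submodule.mem_div_iff_forall_mul_mem.1 hq _ (Submodule.mul_mem_mul hb hc)

end Stable

theorem isPrincipal_of_isUnit {E Q : Type*} [CommRing E] [CommRing Q] [Algebra E Q]
    [IsFractionRing E Q] [Finite (MaximalSpectrum E)] {U : Submodule E Q} (hU : IsUnit U) :
    U.IsPrincipal := by
  obtain ⟨U, rfl⟩ := hU
  have hfrac (V : (Submodule E Q)ˣ) : IsFractional E⁰ (V : Submodule E Q) :=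
    FractionalIdeal.isFractional_of_fg (Submodule.fg_unit V)
  let V : FractionalIdeal E⁰ Q := ⟨U, hfrac U⟩
  let W : FractionalIdeal E⁰ Q := ⟨↑U⁻¹, hfrac U⁻¹⟩
  have hVW : V * W = 1 := FractionalIdeal.coeToSubmodule_injective <|
    (FractionalIdeal.coe_mul V W).trans (U.mul_inv.trans FractionalIdeal.coe_one.symm)
  exact FractionalIdeal.isPrincipal.of_finite_maximals_of_inv le_rfl finite_setOf_isMaximal V W hVW

theorem eq_one_of_isUnit_of_mul_le {E Q : Type*} [CommRing E] [CommRing Q] [Algebra E Q]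
    [IsFractionRing E Q] [Ring.KrullDimLE 1 E] {U D : Submodule E Q} (hU : IsUnit U)
    (h1 : 1 ≤ U) (hD1 : D ≤ 1) (hUD : U * D ≤ D) {d : E} (hd : d ∈ E⁰)
    (hdD : algebraMap E Q d ∈ D) : U = 1 := by
  obtain ⟨U, rfl⟩ := hU
  set N : Submodule E Q := ↑U⁻¹
  have hNU : N * U = 1 := U.inv_mul
  have hN1 : N ≤ 1 := by simpa only [mul_one, hNU] using mul_le_mul_right h1 N
  obtain ⟨A, hA⟩ : ∃ A : Ideal E, IsLocalization.coeSubmodule Q A = N :=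
    ⟨_, Submodule.map_comap_eq_self (Submodule.one_eq_range (R := E) (A := Q) ▸ hN1)⟩
  have hDN (k : ℕ) : D ≤ N ^ k := by
    have hDND : D ≤ N * D := by
      simpa only [← mul_assoc, hNU, one_mul] using mul_le_mul_right hUD N
    suffices D ≤ N ^ k * D by simpa only [mul_one] using this.trans (mul_le_mul_right hD1 (N ^ k))
    induction k with
    | zero => rw [pow_zero, one_mul]
    | succ k ih =>
      rw [pow_succ, mul_assoc]
      exact ih.trans (mul_le_mul_right hDND (N ^ k))
  have hAfg : A.FG := (IsLocalization.coeSubmodule_fg Q (IsFractionRing.injective E Q) A).1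
    (hA ▸ Submodule.fg_of_isUnit U⁻¹.isUnit)
  have hdA (k : ℕ) : d ∈ A ^ k := by
    have hpow : IsLocalization.coeSubmodule Q (A ^ k) = N ^ k :=
      hA ▸ Submodule.map_pow A (Algebra.ofId E Q) k
    obtain ⟨a, ha, had⟩ := hpow.ge (hDN k hdD)
    exact IsFractionRing.injective E Q had ▸ ha
  rw [eq_top_of_forall_mem_pow hAfg hd hdA, IsLocalization.coeSubmodule_top] at hA
  rw [← hNU, ← hA, one_mul]

section StableToQuadratic

variable {R Q : Type*} [CommRing R] [CommRing Q] [Algebra R Q]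

theorem isIntegral_endRing {I : Submodule R Q} (hI : I.FG) (h1 : (1 : Q) ∈ I) :
    Algebra.IsIntegral R (endRing I) := by
  have : Module.Finite R (endModule I) := Module.Finite.iff_fg.2 hI
  let φ : endRing I →ₐ[R] Module.End R (endModule I) := Algebra.lsmul R R (endModule I)
  refine .of_injective (B := Module.End R (endModule I)) φ fun x y hxy => ?_
  have h : (x : Q) * 1 = y * 1 := congrArg Subtype.val (LinearMap.congr_fun hxy ⟨1, h1⟩)
  exact Subtype.ext (by simpa only [mul_one] using h)

variable (Q) in
theorem exists_forall_tower_mul_mem [IsLocalRing R] (hreg : IsRegularIdeal (maximalIdeal R))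
    (n : ℕ) :
    ∃ d ∈ R⁰, ∀ q ∈ tower R Q n, ∃ r, algebraMap R Q r = algebraMap R Q d * q := by
  induction n with
  | zero =>
    refine ⟨1, one_mem _, fun q hq => ?_⟩
    obtain ⟨r, rfl⟩ := Algebra.mem_bot.1 hq
    exact ⟨r, by rw [map_one, one_mul]⟩
  | succ n ih =>
    obtain ⟨m, hm, hmr⟩ := hreg
    obtain ⟨d, hdr, hd⟩ := ih
    have hjac : algebraMap R (tower R Q n) (m * d) ∈ Ideal.jacobson ⊥ := by
      refine Ideal.mem_jacobson_bot.2 fun y => ?_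
      obtain ⟨r, hr⟩ := hd y y.2
      have hmr : algebraMap R (tower R Q n) (m * d) * y = algebraMap R _ (m * r) :=
        Subtype.ext (show algebraMap R Q (m * d) * y = algebraMap R Q (m * r) by
          rw [map_mul, map_mul, hr, mul_assoc])
      rw [hmr, ← map_one (algebraMap R _), ← map_add]
      rw [← jacobson_eq_maximalIdeal ⊥ bot_ne_top] at hm
      exact (Ideal.mem_jacobson_bot.1 hm r).map _
    refine ⟨d * (m * d), mul_mem hdr (mul_mem hmr hdr), fun q hq => ?_⟩
    obtain ⟨r, hr⟩ := hd _ (mem_of_mem_jac (hq _ (coe_mem_jac.2 hjac)))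
    refine ⟨r, hr.trans ?_⟩
    rw [map_mul (algebraMap R Q), mul_assoc, mul_comm q]
    rfl

variable [IsFractionRing R Q]

theorem IsStableRing.isUnit_endModule (hR : IsStableRing R) {I : Submodule R Q}
    (h1 : (1 : Q) ∈ I) {d : R} (hdr : d ∈ R⁰)
    (hd : ∀ q ∈ I, ∃ r, algebraMap R Q r = algebraMap R Q d * q) : IsUnit (endModule I) := by
  obtain ⟨u, hu⟩ := isUnit_algebraMap (Q := Q) hdr
  rw [← hu] at hd
  obtain ⟨I', hI'⟩ : ∃ I' : Ideal R, IsLocalization.coeSubmodule Q I' = u • I := by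
    refine ⟨_, Submodule.map_comap_eq_self ?_⟩
    rintro _ ⟨q, hq, rfl⟩
    exact hd q hq
  have hreg : IsRegularIdeal I' := by
    have hdI' : algebraMap R Q d ∈ IsLocalization.coeSubmodule Q I' :=
      hI' ▸ ⟨1, h1, (mul_one _).trans hu⟩
    obtain ⟨r, hr, hrd⟩ := hdI'
    exact ⟨d, IsFractionRing.injective R Q hrd ▸ hr, hdr⟩
  have hone := (hR I' hreg).one_mem_mul_div (Q := Q) hreg
  rw [hI'] at hone
  exact OneDimStable.isUnit_endModule (one_mem_mul_div_of_smul u hone)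

theorem IsStableRing.le_endRing [IsLocalRing R] [Ring.KrullDimLE 1 R] (hR : IsStableRing R)
    (hreg : IsRegularIdeal (maximalIdeal R)) {n : ℕ} {I : Submodule R Q} (hI : I.FG)
    (h1 : (1 : Q) ∈ I) (hn : I ≤ Subalgebra.toSubmodule (tower R Q n)) :
    I ≤ Subalgebra.toSubmodule (endRing I) := by
  obtain ⟨d, hdr, hd⟩ := exists_forall_tower_mul_mem Q hreg n
  have := isIntegral_endRing hI h1
  have := krullDimLE_one_of_isIntegral R (C := endRing I)
  have := isFractionRing_subalgebra (endRing I)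
  -- The conductor of the `n`-th ring of the tower in `E(I)` absorbs multiplication by `I`.
  let D : Submodule (endRing I) Q :=
    { carrier := {q | ∀ t ∈ tower R Q n, q * t ∈ endRing I}
      zero_mem' := fun t _ => by simp
      add_mem' := fun hp hq t ht => by
        rw [add_mul]
        exact add_mem (hp t ht) (hq t ht)
      smul_mem' := fun c q hq t ht => by
        rw [smul_mul_assoc]
        exact mul_mem c.2 (hq t ht) }
  have hU : endModule I = 1 := by
    refine eq_one_of_isUnit_of_mul_le (hR.isUnit_endModule h1 hdr fun q hq => hd q (hn hq))
      (Submodule.one_le.2 h1) (D := D) (fun q hq => ?_)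
      (Submodule.mul_le.2 fun u hu q hq t ht => ?_)
      (algebraMap_mem_nonZeroDivisors hdr _) fun t ht => ?_
    · exact Submodule.mem_one.2 ⟨⟨q, by simpa using hq 1 (one_mem _)⟩, rfl⟩
    · rw [mul_right_comm, mul_comm]
      exact hq _ (mul_mem (hn hu) ht)
    · obtain ⟨r, hr⟩ := hd t ht
      exact Set.mem_of_eq_of_mem hr.symm (Subalgebra.algebraMap_mem _ r)
  intro q hq
  obtain ⟨e, rfl⟩ := Submodule.mem_one.1 (hU ▸ mem_endModule.2 hq)
  exact e.2

theorem IsStableRing.isQuadraticExtension_towerTop [IsLocalRing R] [Ring.KrullDimLE 1 R]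
    (hR : IsStableRing R) (hreg : IsRegularIdeal (maximalIdeal R)) :
    IsQuadraticExtension R (towerTop R Q) := by
  intro x y
  obtain ⟨n, hx, hy⟩ : ∃ n, (x : Q) ∈ tower R Q n ∧ (y : Q) ∈ tower R Q n := by
    obtain ⟨m, hm⟩ := mem_towerTop.1 x.2
    obtain ⟨n, hn⟩ := mem_towerTop.1 y.2
    exact ⟨max m n, tower_monotone R Q (le_max_left m n) hm,
      tower_monotone R Q (le_max_right m n) hn⟩
  let I : Submodule R Q := Submodule.span R {(x : Q), (y : Q), 1}
  have hn : I ≤ Subalgebra.toSubmodule (tower R Q n) :=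
    Submodule.span_le.2 (by simp [Set.insert_subset_iff, hx, hy])
  have h := hR.le_endRing hreg (Submodule.fg_span (Set.toFinite _))
    (Submodule.subset_span (by simp)) hn (Submodule.subset_span (by simp) : (x : Q) ∈ I)
    y (Submodule.subset_span (by simp))
  obtain ⟨a, b, c, habc⟩ := Submodule.mem_span_triple.1 h
  exact Submodule.mem_span_triple.2 ⟨a, b, c, Subtype.ext habc⟩

end StableToQuadratic

section DedekindToQuadratic

theorem exists_int_sub_mul_sub_mem_jacobson_bot {S : Type*} [CommRing S]
    [Finite (MaximalSpectrum S)] (hcard : Nat.card (MaximalSpectrum S) < 4)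
    (hres : ∀ P : MaximalSpectrum S, ∀ z, z ∈ P.asIdeal ∨ z - 1 ∈ P.asIdeal) (x y : S) :
    ∃ a b : ℤ, (x - a) * (y - b) ∈ Ideal.jacobson (⊥ : Ideal S) := by
  classical
  -- Some pair of residues in `𝔽₂ × 𝔽₂` is not attained by `(x, y)` at any maximal ideal.
  obtain ⟨⟨p, q⟩, hpq⟩ : ∃ pq : Prop × Prop, ∀ P : MaximalSpectrum S,
      (x ∈ P.asIdeal, y ∈ P.asIdeal) ≠ pq := by
    have := Fintype.ofFinite (MaximalSpectrum S)
    by_contra! h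
    have := Fintype.card_le_of_surjective
      (fun P : MaximalSpectrum S => (x ∈ P.asIdeal, y ∈ P.asIdeal)) h
    rw [Fintype.card_prod, Fintype.card_prop, ← Nat.card_eq_fintype_card] at this
    omega
  have hsub {z : S} {P : MaximalSpectrum S} {p : Prop} (h : (z ∈ P.asIdeal) ≠ p) :
      z - ((if p then 1 else 0 : ℤ) : S) ∈ P.asIdeal := by
    by_cases hp : p
    · simp_all [(hres P z).resolve_left]
    · simp_all
  refine ⟨if p then 1 else 0, if q then 1 else 0, Submodule.mem_sInf.2 fun P hP => ?_⟩
  obtain ⟨P, rfl⟩ : ∃ P' : MaximalSpectrum S, P'.asIdeal = P := ⟨⟨P, hP.2⟩, rfl⟩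
  rcases Classical.em ((x ∈ P.asIdeal) = p) with hx | hx
  · exact P.asIdeal.mul_mem_left _ (hsub fun hy => hpq P (Prod.ext hx hy))
  · exact P.asIdeal.mul_mem_right _ (hsub hx)

theorem isQuadraticExtension_of_forall_mem_jacobson_bot {R S : Type*} [CommRing R] [CommRing S]
    [Algebra R S]
    (hR : ∀ z ∈ Ideal.jacobson (⊥ : Ideal S), ∃ r, algebraMap R S r = z)
    (hS : ∀ x y : S, ∃ a b : ℤ, (x - a) * (y - b) ∈ Ideal.jacobson (⊥ : Ideal S)) :
    IsQuadraticExtension R S := by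
  intro x y
  obtain ⟨a, b, hab⟩ := hS x y
  obtain ⟨r, hr⟩ := hR _ hab
  refine Submodule.mem_span_triple.2 ⟨b, a, r - a * b, ?_⟩
  simp only [Algebra.smul_def, map_sub, map_mul, map_intCast, hr]
  ring

variable {R Q : Type*} [CommRing R] [CommRing Q] [Algebra R Q] [IsFractionRing R Q]
  [IsLocalRing R] {S : Subalgebra R Q}

theorem jac_eq_jac_bot (h2 : (2 : Q) ∈ jac S)
    (hrange : Set.range (algebraMap R Q) =
      algebraMap R Q '' ((⊥ : Subring R) : Set R) + (jac S : Set Q)) :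
    jac S = jac (⊥ : Subalgebra R Q) := by
  have := (IsFractionRing.injective R Q).nontrivial
  have hle {q : Q} (hq : q ∈ jac S) : ∃ r ∈ maximalIdeal R, algebraMap R Q r = q := by
    obtain ⟨r, rfl⟩ := hrange.ge ⟨0, ⟨0, zero_mem _, map_zero _⟩, q, hq, zero_add q⟩
    exact ⟨r, mem_maximalIdeal_of_algebraMap_mem_jacobson_bot (C := S) (coe_mem_jac.1 hq), rfl⟩
  have h2R : (2 : R) ∈ maximalIdeal R := by
    obtain ⟨r, hr, hr2⟩ := hle h2
    exact (FaithfulSMul.algebraMap_injective R Q (hr2.trans (map_ofNat _ 2).symm)) ▸ hr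
  refine jac_bot (R := R) (Q := Q) ▸ le_antisymm (fun q hq => hle hq) ?_
  rintro _ ⟨r, hr, rfl⟩
  obtain ⟨_, ⟨_, ⟨n, rfl⟩, rfl⟩, q, hq, hrq⟩ := hrange.le ⟨r, rfl⟩
  obtain ⟨r', hr', rfl⟩ := hle hq
  rw [Algebra.linearMap_apply, ← hrq]
  refine add_mem ?_ hq
  have hn : (n : R) ∈ maximalIdeal R := by
    rw [show (n : R) = r - r' from IsFractionRing.injective R Q (by simp [← hrq])]
    exact sub_mem hr hr'
  rcases Int.even_or_odd' n with ⟨k, rfl | rfl⟩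
  · have hk := (jac S).smul_mem (k : R) h2
    simpa [Algebra.smul_def, mul_comm, map_ofNat (algebraMap R Q) 2] using hk
  · have h1 := sub_mem hn (Ideal.mul_mem_right (k : R) _ h2R)
    exact absurd h1 (by simp)

theorem IsDedekindWithZeroDivisors.isQuadraticRing
    (hreg : IsRegularIdeal (maximalIdeal R)) (hS : IsDedekindWithZeroDivisors S)
    (hcard : {N : Ideal S | N.IsMaximal}.ncard = 3)
    (hres : ∀ N : Ideal S, N.IsMaximal → Nonempty (S ⧸ N ≃+* ZMod 2))
    (hrange : Set.range (algebraMap R Q) =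
      algebraMap R Q '' ((⊥ : Subring R) : Set R) + (jac S : Set Q)) :
    IsQuadraticRing R Q := by
  have := (IsFractionRing.injective R Q).nontrivial
  rw [ncard_setOf_isMaximal] at hcard
  have : Finite (MaximalSpectrum S) := Nat.finite_of_card_ne_zero (by omega)
  have hres' (P : MaximalSpectrum S) : ∀ z, z ∈ P.asIdeal ∨ z - 1 ∈ P.asIdeal :=
    have := P.2
    nonempty_quotient_ringEquiv_zmod_two_iff.1 (hres P.asIdeal P.2)
  have h2 : (2 : Q) ∈ jac S := by
    refine (coe_mem_jac (x := 2)).2 (Submodule.mem_sInf.2 fun P hP => ?_)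
    refine (hres' ⟨P, hP.2⟩ 2).resolve_right fun h => hP.2.ne_top ((Ideal.eq_top_iff_one P).2 ?_)
    rwa [show (2 : S) - 1 = 1 by norm_num] at h
  have hjac := jac_eq_jac_bot h2 hrange
  have hmem {z : S} (hz : z ∈ Ideal.jacobson (⊥ : Ideal S)) :
      ∃ r ∈ maximalIdeal R, algebraMap R S r = z := by
    have hz' := coe_mem_jac.2 hz
    rw [hjac, jac_bot] at hz'
    obtain ⟨r, hr, hrz⟩ := hz'
    exact ⟨r, hr, Subtype.ext hrz⟩
  have hprin : IsRegularPrincipal (Ideal.jacobson (⊥ : Ideal S)) := by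
    obtain ⟨i, hi, hir⟩ := hreg
    refine hS.isRegularPrincipal ⟨algebraMap R S i, ?_, algebraMap_mem_nonZeroDivisors hir S⟩
    rw [← coe_mem_jac, hjac, jac_bot]
    exact ⟨i, hi, rfl⟩
  have hq : IsQuadraticExtension R S := isQuadraticExtension_of_forall_mem_jacobson_bot
    (fun z hz => (hmem hz).imp fun _ => And.right)
    (exists_int_sub_mul_sub_mem_jacobson_bot (by omega) hres')
  refine ⟨towerTop_eq_of_jac_eq_jac_bot hjac hprin ▸ hq, ?_, hreg⟩
  obtain ⟨j, hj, hspan⟩ := hprin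
  obtain ⟨i, hi, rfl⟩ := hmem (hspan ▸ Ideal.mem_span_singleton_self j)
  have := hq.isIntegral
  refine isStableIdeal_of_map_eq_span (algebraMap_subalgebra_injective R S) hq hi
    (mem_nonZeroDivisors_of_injective (algebraMap_subalgebra_injective R S) hj)
    (le_antisymm (map_maximalIdeal_le_jacobson_bot.trans hspan.le) ?_)
  exact (Ideal.span_singleton_le_iff_mem _).2 (Ideal.mem_map_of_mem _ hi)

end DedekindToQuadratic

section QuadraticToStableOrDedekind

variable {R Q : Type*} [CommRing R] [CommRing Q] [Algebra R Q]

theorem inclusion_mem_iff_mem_maximalIdeal {C B : Subalgebra R Q} [IsLocalRing C]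
    [Algebra.IsIntegral R B] (h : C ≤ B) (P : Ideal B) [P.IsMaximal] {c : C} :
    Subalgebra.inclusion h c ∈ P ↔ c ∈ maximalIdeal C := by
  algebraize [(Subalgebra.inclusion h).toRingHom]
  have : IsScalarTower R C B := .of_algebraMap_eq fun _ => rfl
  have : Algebra.IsIntegral C B := .tower_top R
  exact algebraMap_mem_iff_mem_maximalIdeal P

variable [IsFractionRing R Q]

theorem IsQuadraticRing.exists_jac_bot_eq_smul (hR : IsQuadraticRing R Q) :
    ∃ m ∈ R⁰, jac (⊥ : Subalgebra R Q) = m • Subalgebra.toSubmodule (tower R Q 1) := by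
  have := hR.isLocalRing
  have := (IsFractionRing.injective R Q).nontrivial
  have : Finite (MaximalSpectrum (endRing (jac (⊥ : Subalgebra R Q)))) :=
    (hR.isQuadraticExtension.of_le (tower_le_towerTop R Q 1)).finite_maximalSpectrum
  have := isFractionRing_subalgebra (endRing (jac (⊥ : Subalgebra R Q)))
  have hone := hR.isStableIdeal.one_mem_mul_div (Q := Q) hR.isRegularIdeal
  rw [← jac_bot] at hone
  obtain ⟨g, hg⟩ := (isPrincipal_of_isUnit (isUnit_endModule hone)).principal
  have hmem {q : Q} : q ∈ jac (⊥ : Subalgebra R Q) ↔ ∃ c ∈ tower R Q 1, c * g = q := by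
    rw [← mem_endModule, hg, Submodule.mem_span_singleton]
    exact ⟨fun ⟨c, hc⟩ => ⟨c, c.2, hc⟩, fun ⟨c, hc, h⟩ => ⟨⟨c, hc⟩, h⟩⟩
  obtain ⟨m, -, rfl⟩ := jac_bot.le (hmem.2 ⟨1, one_mem _, one_mul g⟩)
  refine ⟨m, ?_, ?_⟩
  · obtain ⟨d, hd, hdr⟩ := hR.isRegularIdeal
    obtain ⟨c, -, hc⟩ := hmem.1 (jac_bot.ge ⟨d, hd, rfl⟩)
    have hu : IsUnit (c * algebraMap R Q m) := hc ▸ isUnit_algebraMap hdr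
    exact mem_nonZeroDivisors_of_injective (IsFractionRing.injective R Q)
      (isUnit_of_mul_isUnit_right hu).mem_nonZeroDivisors
  · ext q
    simp only [hmem, Submodule.mem_smul_pointwise_iff_exists, Algebra.smul_def, mul_comm]
    rfl

theorem map_maximalIdeal_eq_span [IsLocalRing R] {m : R}
    (hgen : jac (⊥ : Subalgebra R Q) = m • Subalgebra.toSubmodule (tower R Q 1))
    {C : Subalgebra R Q} (hC : tower R Q 1 ≤ C) :
    (maximalIdeal R).map (algebraMap R C) = Ideal.span {algebraMap R C m} := by
  have := (IsFractionRing.injective R Q).nontrivial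
  rw [jac_bot] at hgen
  refine le_antisymm (Ideal.map_le_iff_le_comap.2 fun r hr => ?_) ?_
  · obtain ⟨c, hc, hrc⟩ := hgen.le ⟨r, hr, rfl⟩
    exact Ideal.mem_span_singleton.2
      ⟨⟨c, hC hc⟩, Subtype.ext (hrc.symm.trans (Algebra.smul_def m c))⟩
  · obtain ⟨m', hm', h⟩ := hgen.ge ⟨1, (tower R Q 1).one_mem, rfl⟩
    obtain rfl : m' = m := IsFractionRing.injective R Q (h.trans (by simp [Algebra.smul_def]))
    exact (Ideal.span_singleton_le_iff_mem _).2 (Ideal.mem_map_of_mem _ hm')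

theorem isRegularPrincipal_jacobson_or_jac_eq_smul [IsLocalRing R] {m : R} (hm : m ∈ R⁰)
    {C : Subalgebra R Q} [IsLocalRing C] (hq : IsQuadraticExtension R C)
    (hspan : (maximalIdeal R).map (algebraMap R C) = Ideal.span {algebraMap R C m}) :
    IsRegularPrincipal (Ideal.jacobson (⊥ : Ideal C)) ∨
      jac C = m • Subalgebra.toSubmodule (endRing (jac C)) := by
  have := (IsFractionRing.injective R Q).nontrivial
  have := hq.isIntegral
  have hm' : algebraMap R C m ∈ Ideal.jacobson (⊥ : Ideal C) :=
    map_maximalIdeal_le_jacobson_bot (hspan.ge (Ideal.mem_span_singleton_self _))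
  have hdvd {x y : C} (hx : x ∈ Ideal.jacobson (⊥ : Ideal C))
      (hy : y ∈ Ideal.jacobson (⊥ : Ideal C)) : algebraMap R C m ∣ x * y :=
    Ideal.mem_span_singleton.1 (hspan ▸ hq.mul_mem_map_maximalIdeal hx hy)
  refine or_iff_not_imp_left.2 fun hnot => le_antisymm ?_ ?_
  · rintro _ ⟨z, hz, rfl⟩
    obtain ⟨u, hu⟩ := isUnit_algebraMap (Q := Q) hm
    refine ⟨↑u⁻¹ * z, ?_, (Algebra.smul_def m _).trans (hu ▸ u.mul_inv_cancel_left z)⟩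
    rintro _ ⟨x, hx, rfl⟩
    obtain ⟨c, hc⟩ := hdvd hz hx
    have hcQ : (↑u⁻¹ * z * x : Q) = c := by
      rw [mul_assoc, u.inv_mul_eq_iff_eq_mul, hu]
      exact congrArg Subtype.val hc
    refine hcQ ▸ coe_mem_jac.2 (by_contra fun hcJ => hnot ?_)
    -- `c` is a unit, so `m` is a product of two elements of `Jac C`.
    obtain ⟨c, rfl⟩ : IsUnit c := by
      rwa [jacobson_eq_maximalIdeal ⊥ bot_ne_top, notMem_maximalIdeal] at hcJ
    have hzx : ↑c⁻¹ * z * x = algebraMap R C m := by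
      rw [mul_assoc, hc, mul_comm, mul_assoc, c.mul_inv, mul_one]
    exact .of_mul_mem_nonZeroDivisors hx (hzx ▸ algebraMap_mem_nonZeroDivisors hm C)
      fun y hy => hzx ▸ hdvd (Ideal.mul_mem_left _ _ hz) hy
  · rintro _ ⟨q, hq, rfl⟩
    rw [DistribSMul.toLinearMap_apply, Algebra.smul_def, mul_comm]
    exact hq _ (coe_mem_jac.2 hm')

theorem isRegularPrincipal_jacobson_or_isLocalRing [IsLocalRing R] {m : R} (hm : m ∈ R⁰)
    {C : Subalgebra R Q} (hq : IsQuadraticExtension R C)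
    (hspan : (maximalIdeal R).map (algebraMap R C) = Ideal.span {algebraMap R C m}) :
    IsRegularPrincipal (Ideal.jacobson (⊥ : Ideal C)) ∨
      IsLocalRing C ∧ jac C = m • Subalgebra.toSubmodule (endRing (jac C)) := by
  have := (IsFractionRing.injective R Q).nontrivial
  rcases subsingleton_or_nontrivial (MaximalSpectrum C) with _ | _
  · have : IsLocalRing C := .of_singleton_maximalSpectrum
    exact (isRegularPrincipal_jacobson_or_jac_eq_smul hm hq hspan).imp_right (⟨this, ·⟩)
  · obtain ⟨P, P', hne⟩ := exists_pair_ne (MaximalSpectrum C)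
    exact .inl ⟨_, algebraMap_mem_nonZeroDivisors hm C,
      (hq.jacobson_bot_eq_map_maximalIdeal hne).trans hspan⟩

theorem IsQuadraticRing.isRegularPrincipal_jacobson_towerTop (hR : IsQuadraticRing R Q) :
    IsRegularPrincipal (Ideal.jacobson (⊥ : Ideal (towerTop R Q))) := by
  have := hR.isLocalRing
  have := (IsFractionRing.injective R Q).nontrivial
  have hint := hR.isQuadraticExtension.isIntegral
  obtain ⟨m, hm, hgen⟩ := hR.exists_jac_bot_eq_smul
  by_cases h : ∃ n, IsRegularPrincipal (Ideal.jacobson (⊥ : Ideal (tower R Q (n + 1))))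
  · obtain ⟨n, hn⟩ := h
    rwa [towerTop_eq_of_endRing_eq (endRing_jac_eq hn)]
  have hlocal (n : ℕ) := (isRegularPrincipal_jacobson_or_isLocalRing hm
    (hR.isQuadraticExtension.of_le (tower_le_towerTop R Q (n + 1)))
    (map_maximalIdeal_eq_span hgen (tower_monotone R Q (Nat.le_add_left 1 n)))).resolve_left
    fun hn => h ⟨n, hn⟩
  have hspan := map_maximalIdeal_eq_span hgen (tower_le_towerTop R Q 1)
  refine ⟨algebraMap R _ m, algebraMap_mem_nonZeroDivisors hm _,
    le_antisymm (fun q hq => ?_) (hspan.ge.trans map_maximalIdeal_le_jacobson_bot)⟩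
  obtain ⟨n, hn⟩ := mem_towerTop.1 q.2
  have hn' : (q : Q) ∈ tower R Q (n + 1) := tower_monotone R Q n.le_succ hn
  have := (hlocal n).1
  obtain ⟨P, hP⟩ := Ideal.exists_maximal (towerTop R Q)
  have hq' : (q : Q) ∈ jac (tower R Q (n + 1)) := by
    rw [← Subtype.coe_mk (q : Q) hn', coe_mem_jac, jacobson_eq_maximalIdeal ⊥ bot_ne_top,
      ← inclusion_mem_iff_mem_maximalIdeal (tower_le_towerTop R Q (n + 1)) P]
    exact jacobson_bot_le_of_isMaximal P hq
  obtain ⟨c, hc, hcq⟩ := (hlocal n).2.le hq'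
  exact Ideal.mem_span_singleton.2 ⟨⟨c, tower_le_towerTop R Q (n + 2) hc⟩,
    Subtype.ext (hcq.symm.trans (Algebra.smul_def m c))⟩

theorem IsQuadraticRing.isRegularPrincipal [Ring.KrullDimLE 1 R] (hR : IsQuadraticRing R Q)
    {K : Ideal (towerTop R Q)} (hK : IsRegularIdeal K) : IsRegularPrincipal K := by
  have := hR.isLocalRing
  have hq := hR.isQuadraticExtension
  have := hq.isIntegral
  have := hq.finite_maximalSpectrum
  have := krullDimLE_one_of_isIntegral R (C := towerTop R Q)
  exact .of_isRegularIdeal hR.isRegularPrincipal_jacobson_towerTop hK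

theorem IsQuadraticRing.isStableRing [Ring.KrullDimLE 1 R] (hR : IsQuadraticRing R Q)
    {P P' : MaximalSpectrum (towerTop R Q)} (hP : ∀ N, N = P ∨ N = P') : IsStableRing R := by
  rintro I ⟨d, hd, hdr⟩
  have hmap : IsRegularPrincipal (I.map (algebraMap R (towerTop R Q))) :=
    hR.isRegularPrincipal
      ⟨_, Ideal.mem_map_of_mem _ hd, algebraMap_mem_nonZeroDivisors hdr _⟩
  obtain ⟨i, hi, hspan⟩ := exists_map_eq_span_algebraMap hmap hP
  have hinj := algebraMap_subalgebra_injective R (towerTop R Q)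
  refine isStableIdeal_of_map_eq_span hinj hR.isQuadraticExtension hi ?_ hspan
  obtain ⟨c, hc⟩ := Ideal.mem_span_singleton.1 (hspan ▸ Ideal.mem_map_of_mem _ hd)
  have hreg := hc ▸ algebraMap_mem_nonZeroDivisors hdr (towerTop R Q)
  exact mem_nonZeroDivisors_of_injective hinj (mul_mem_nonZeroDivisors.1 hreg).1

theorem IsQuadraticRing.towerTop_eq_tower_one (hR : IsQuadraticRing R Q)
    (P : Fin 3 ↪ MaximalSpectrum (towerTop R Q)) : towerTop R Q = tower R Q 1 := by
  have := hR.isLocalRing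
  have hq := hR.isQuadraticExtension
  have := hq.isIntegral
  have hle := tower_le_towerTop R Q 1
  obtain ⟨m, hm, hgen⟩ := hR.exists_jac_bot_eq_smul
  rcases isRegularPrincipal_jacobson_or_isLocalRing hm (hq.of_le hle)
    (map_maximalIdeal_eq_span hgen le_rfl) with hjac | ⟨_, -⟩
  · exact towerTop_eq_of_endRing_eq (endRing_jac_eq hjac)
  exfalso
  have hm' := algebraMap_mem_nonZeroDivisors hm (towerTop R Q)
  obtain ⟨s, hs, y, hsy, hy1, hy2⟩ :=
    hq.exists_mem_maximalIdeal_eq_mul P hm' (map_maximalIdeal_eq_span hgen hle)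
  obtain ⟨c, rfl⟩ : ∃ c, Subalgebra.inclusion hle c = y := by
    have := (IsFractionRing.injective R Q).nontrivial
    obtain ⟨c, hc, hcs⟩ := (jac_bot.symm.trans hgen).le ⟨s, hs, rfl⟩
    refine ⟨⟨c, hc⟩, (mul_cancel_left_mem_nonZeroDivisors hm').1 (hsy ▸ Subtype.ext ?_)⟩
    exact (Algebra.smul_def m c).symm.trans hcs
  have hc := (inclusion_mem_iff_mem_maximalIdeal hle (P 1).asIdeal).1 hy1
  have := (inclusion_mem_iff_mem_maximalIdeal hle (P 2).asIdeal).2 hc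
  exact (P 2).2.ne_top ((Ideal.eq_top_iff_one _).2 ((Ideal.add_mem_iff_right _ this).1 hy2))

theorem IsQuadraticRing.jac_towerTop_eq (hR : IsQuadraticRing R Q)
    (P : Fin 3 ↪ MaximalSpectrum (towerTop R Q)) :
    jac (towerTop R Q) = jac (⊥ : Subalgebra R Q) := by
  have := hR.isLocalRing
  obtain ⟨m, -, hgen⟩ := hR.exists_jac_bot_eq_smul
  have hjac := hR.isQuadraticExtension.jacobson_bot_eq_map_maximalIdeal
    (P.injective.ne (by decide : (0 : Fin 3) ≠ 1))
  rw [map_maximalIdeal_eq_span hgen (tower_le_towerTop R Q 1)] at hjac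
  ext q
  rw [hgen, ← hR.towerTop_eq_tower_one P, mem_jac, hjac, Submodule.mem_smul_pointwise_iff_exists]
  simp only [Ideal.mem_span_singleton', Algebra.smul_def]
  constructor
  · rintro ⟨_, ⟨c, rfl⟩, rfl⟩
    exact ⟨c, c.2, mul_comm _ _⟩
  · rintro ⟨c, hc, rfl⟩
    exact ⟨_, ⟨⟨c, hc⟩, rfl⟩, mul_comm _ _⟩

theorem IsQuadraticRing.range_algebraMap_eq (hR : IsQuadraticRing R Q)
    (P : Fin 3 ↪ MaximalSpectrum (towerTop R Q)) :
    Set.range (algebraMap R Q) =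
      algebraMap R Q '' ((⊥ : Subring R) : Set R) + (jac (towerTop R Q) : Set Q) := by
  have := hR.isLocalRing
  have := (IsFractionRing.injective R Q).nontrivial
  have hq := hR.isQuadraticExtension
  have := hq.isIntegral
  rw [hR.jac_towerTop_eq P, jac_bot]
  refine subset_antisymm ?_ ?_
  · rintro _ ⟨r, rfl⟩
    rcases hq.mem_or_sub_one_mem P (P 0).asIdeal (algebraMap R _ r) with h | h
    · rw [algebraMap_mem_iff_mem_maximalIdeal] at h
      exact ⟨0, ⟨0, zero_mem _, map_zero _⟩, _, ⟨r, h, rfl⟩, zero_add _⟩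
    · rw [← map_one (algebraMap R _), ← map_sub, algebraMap_mem_iff_mem_maximalIdeal] at h
      exact ⟨1, ⟨1, one_mem _, map_one _⟩, _, ⟨r - 1, h, rfl⟩, by simp⟩
  · rintro _ ⟨_, ⟨n, -, rfl⟩, _, ⟨r, -, rfl⟩, rfl⟩
    exact ⟨n + r, map_add _ _ _⟩

theorem IsQuadraticRing.exists_isDedekindWithZeroDivisors [Ring.KrullDimLE 1 R]
    (hR : IsQuadraticRing R Q) (P : Fin 3 ↪ MaximalSpectrum (towerTop R Q)) :
    ∃ S : Subalgebra R Q, IsDedekindWithZeroDivisors S ∧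
      {N : Ideal S | N.IsMaximal}.ncard = 3 ∧
      (∀ N : Ideal S, N.IsMaximal → Nonempty (S ⧸ N ≃+* ZMod 2)) ∧
      Set.range (algebraMap R Q) =
        algebraMap R Q '' ((⊥ : Subring R) : Set R) + (jac S : Set Q) := by
  have := hR.isLocalRing
  have hq := hR.isQuadraticExtension
  refine ⟨towerTop R Q, fun K hK => (hR.isRegularPrincipal hK).isUnit_coeIdeal, ?_,
    fun N hN => nonempty_quotient_ringEquiv_zmod_two_iff.2 (hq.mem_or_sub_one_mem P N),
    hR.range_algebraMap_eq P⟩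
  rw [ncard_setOf_isMaximal,
    ← Nat.card_congr (Equiv.ofBijective P (hq.bijective_fin_three_embedding P)), Nat.card_fin]

end QuadraticToStableOrDedekind

end OneDimStable

theorem corollary4p4 {R Q : Type*} [CommRing R] [CommRing Q] [Algebra R Q] [IsFractionRing R Q]
    [IsLocalRing R] (hdim : ringKrullDim R = 1)
    (hreg : OneDimStable.IsRegularIdeal (IsLocalRing.maximalIdeal R)) :
    OneDimStable.IsQuadraticRing R Q ↔
      (OneDimStable.IsStableRing R ∨
        ∃ S : Subalgebra R Q,
          OneDimStable.IsDedekindWithZeroDivisors S ∧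
          {N : Ideal S | N.IsMaximal}.ncard = 3 ∧
          (∀ N : Ideal S, N.IsMaximal → Nonempty (S ⧸ N ≃+* ZMod 2)) ∧
          Set.range (algebraMap R Q) =
            algebraMap R Q '' ((⊥ : Subring R) : Set R) + (OneDimStable.jac S : Set Q)) := by
  have : Ring.KrullDimLE 1 R := Ring.krullDimLE_iff.2 (by rw [hdim]; rfl)
  constructor
  · intro hR
    have : Nontrivial Q := (IsFractionRing.injective R Q).nontrivial
    rcases OneDimStable.exists_forall_eq_or_eq_or_nonempty_fin_three_embedding
      (MaximalSpectrum (OneDimStable.towerTop R Q)) with ⟨P, P', hP⟩ | ⟨⟨P⟩⟩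
    · exact .inl (hR.isStableRing hP)
    · exact .inr (hR.exists_isDedekindWithZeroDivisors P)
  · rintro (hR | ⟨S, hS, hcard, hres, hrange⟩)
    · exact ⟨hR.isQuadraticExtension_towerTop hreg, hR _ hreg, hreg⟩
    · exact hS.isQuadraticRing hreg hcard hres hrange
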